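/- Let $(q_k)_{k\in\mathbb N}$ be a sequence of complex polynomials of degrees $n_k\ge 1$ with $n_k\to\infty$. Let $z_{k,1},\dots,z_{k,n_k}$ be the roots of $q_k$ repeated with multiplicity, let $\mu_k^{\#}=\sum_{j}\delta_{z_{k,j}}$, and let $\mu_k=\frac1{n_k}\mu_k^{\#}$. For a finite Borel measure $\mu$ on $\mathbb C$ with compact support, let $I(\mu)=\iint\log|z-w|\,d\mu(w)\,d\mu(z)\in[-\infty,\infty)$ be its energy. A compact set $K\subset\mathbb C$ is polar if $I(\mu)=-\infty$ for every non-zero finite Borel measure $\mu$ with support contained in $K$. An equilibrium measure of $K$ is a Borel probability measure on $K$ that maximizes $I$ among all Borel probability measures on $K$. The set $K$ is polynomially convex if for every $z\in\mathbb C\setminus K$ there is a polynomial $p$ with $|p(z)|>\sup_K|p|$. An open set $U\subset\mathbb C$ is root-sparse for $(q_k)_k$ if for every compact $C\subset U$ there is $M$ such that $\mu_k^{\#}(C)\le M$ for all sufficiently large $k$. For a non-zero polynomial $q$ and an open set $U$, let $\xi_q(z)$ be the order of vanishing of $q$ at $z\in U$. A divisor $\xi$ on $U$ (a function $U\to\mathbb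 Z$ whose non-zero locus has no accumulation point in $U$) acts on continuous functions $f:U\to\mathbb C$ with compact support in $U$ by $\xi(f)=\sum_z\xi(z)f(z)$, and $\xi_k\to\xi$ on $U$ means $\xi_k(f)\to\xi(f)$ for every such $f$. **Corollary.** Let $K\subset\mathbb C$ be a non-polar, polynomially convex, connected compact set with equilibrium measure $\omega$. Suppose that $\mu_k\to\omega$ weak*, that is, $\int\varphi\,d\mu_k\to\int\varphi\,d\omega$ for every continuous $\varphi:\mathbb C\to\mathbb R$ with compact support, and that $U=\mathbb C\setminus K$ is root-sparse for $(q_k)_k$. Then for every $m=0,1,2,\dots$ $$\xi_{q_k^{(m)}}-\xi_{q_k}\longrightarrow 0\quad\text{on }U\text{ as }k\to\infty$$ (where $q_k^{(m)}\neq0$ for all sufficiently large $k$). -/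

import Mathlib

open Filter Topology MeasureTheory Polynomial
open scoped ENNReal

noncomputable section

namespace RootSparse

/-- The root-counting measure `∑ⱼ δ_{zⱼ}` of a polynomial, over its roots `zⱼ` repeated with
multiplicity. -/
def rootCountingMeasure (q : ℂ[X]) : Measure ℂ :=
  (q.roots.map fun z => Measure.dirac z).sum

/-- The root distribution: the root-counting measure divided by the degree. It is a probability
measure as soon as the degree is positive. -/
def rootDistribution (q : ℂ[X]) : Measure ℂ :=
  (q.natDegree : ℝ≥0∞)⁻¹ • rootCountingMeasure q

/-- Root-sparsity of an open set `U` for the sequence `q`: on each compact subset of `U` the number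
of roots of `q k`, counted with multiplicity, is bounded for all large `k`. -/
def IsRootSparse (q : ℕ → ℂ[X]) (U : Set ℂ) : Prop :=
  IsOpen U ∧ ∀ C : Set ℂ, IsCompact C → C ⊆ U →
    ∃ M : ℕ, ∀ᶠ k in atTop, rootCountingMeasure (q k) C ≤ (M : ℝ≥0∞)

/-- Weak* convergence of measures: convergence of the integrals of every continuous function with
compact support. (If all `μ k` and `ν` are probability measures on the plane, this is the same as
weak* convergence on the Riemann sphere, and as testing against bounded continuous functions.) -/
def WeakStarTendsto (μ : ℕ → Measure ℂ) (ν : Measure ℂ) : Prop :=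
  ∀ φ : ℂ → ℝ, Continuous φ → HasCompactSupport φ →
    Tendsto (fun k => ∫ z, φ z ∂(μ k)) atTop (𝓝 (∫ z, φ z ∂ν))

/-- The logarithmic energy `I(μ) = ∬ log |z - w| dμ(w) dμ(z)` with values in `[-∞, ∞]`, as the
integral of the positive part minus the integral of the negative part, where `log 0 = -∞`.
For finite measures with compact support the positive part has a finite integral. -/
def logEnergy (μ : Measure ℂ) : EReal :=
  ((∫⁻ z, ∫⁻ w, (ENNReal.log ‖z - w‖ₑ).toENNReal ∂μ ∂μ : ℝ≥0∞) : EReal) -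
    ((∫⁻ z, ∫⁻ w, (-ENNReal.log ‖z - w‖ₑ).toENNReal ∂μ ∂μ : ℝ≥0∞) : EReal)

/-- A set is polar if every nonzero finite Borel measure whose support is a compact subset of it has
energy `-∞`. -/
def IsPolar (E : Set ℂ) : Prop :=
  ∀ μ : Measure ℂ, IsFiniteMeasure μ → μ ≠ 0 → IsCompact μ.support → μ.support ⊆ E →
    logEnergy μ = ⊥

/-- `ω` is an equilibrium measure of the compact set `K`: a Borel probability measure on `K` with
maximal energy (in the sign convention above) among all Borel probability measures on `K`. -/
def IsEquilibriumMeasure (ω : Measure ℂ) (K : Set ℂ) : Prop :=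
  IsProbabilityMeasure ω ∧ ω Kᶜ = 0 ∧
    ∀ μ : Measure ℂ, IsProbabilityMeasure μ → μ Kᶜ = 0 → logEnergy μ ≤ logEnergy ω

/-- The polynomial hull of `K`: all `z` with `|p z| ≤ sup_K |p|` for every polynomial `p`. -/
def polynomialHull (K : Set ℂ) : Set ℂ :=
  {z | ∀ (p : ℂ[X]) (M : ℝ), (∀ w ∈ K, ‖p.eval w‖ ≤ M) → ‖p.eval z‖ ≤ M}

/-- A set is polynomially convex if it equals its polynomial hull. -/
def IsPolynomiallyConvex (K : Set ℂ) : Prop :=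
  polynomialHull K = K

/-- The divisor on `U` of a polynomial: at each point of `U` the order of vanishing. -/
def polyDivisor (U : Set ℂ) (p : ℂ[X]) : Function.locallyFinsuppWithin U ℤ :=
  MeromorphicOn.divisor (fun z => p.eval z) U

/-- The action `ξ(f) = ∑_z ξ(z) f(z)` of a divisor on a function. The sum is finite if `f` has
compact support in `U`. -/
def divisorPairing {U : Set ℂ} (ξ : Function.locallyFinsuppWithin U ℤ) (f : ℂ → ℂ) : ℂ :=
  ∑ᶠ z, (ξ z : ℂ) * f z

/-- Weak* convergence of divisors on `U`, against continuous functions with compact support in `U`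
(extended by zero to the plane). -/
def DivisorTendsto {U : Set ℂ} (ξ : ℕ → Function.locallyFinsuppWithin U ℤ)
    (η : Function.locallyFinsuppWithin U ℤ) : Prop :=
  ∀ f : ℂ → ℂ, Continuous f → HasCompactSupport f → tsupport f ⊆ U →
    Tendsto (fun k => divisorPairing (ξ k) f) atTop (𝓝 (divisorPairing η f))

end RootSparse

end

/-! Write `n` for the degree of `q k` and `F_m` for `q_k^(m) / (n^m q_k)`. By the quotient rule
`F_{m+1} = F_m' / n + F_m F_1`, and `F_1` is the average of `1 / (z - w)` over the roots `w`. Hence,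
off `K` and away from the roots, weak* convergence gives `F_m → C ^ m` locally uniformly, where `C`
is the Cauchy transform of `ω`. If `C` has no zeros off `K`, the logarithmic derivative of `F_m` has
nearly zero integral over small circles free of roots. The argument principle then gives `q_k` and
its `m`-th derivative equally many roots inside (`RootAvgTendsto.eventually_rootCount_eq`).
Root-sparsity enters by compactness: along an ultrafilter the roots in a compact set cluster at
finitely many points, so sums over roots are governed by counts in finitely many small discs
(`RootAvgTendsto.tendsto_sum_roots_sub`).

The heart is that `C` has no zeros off `K` (`IsEquilibriumMeasure.cauchyTransform_ne_zero`).
Classically the complement of `K` in the sphere is simply connected, the potential of `ω` minus the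
maximal energy `I` is its Green function, hence the log-modulus of a conformal map, and so it has no
critical points. The proof discretizes this. As `C` depends only on `ω`, the `q k` may be replaced
by monic `p k` with all roots in the support of `ω`. Connectedness of `K` gives `p k` a holomorphic
`n`-th root `φ` off a neighbourhood of `K`. If `|p k| ≤ e^{cn}` near `K`, then `φ` maps `{|p k| >
e^{cn}}` onto `{|w| > e^c}`, being open and proper there. So each value of `p k` of modulus greater
than `e^{cn}` has `n` distinct preimages and is not critical (`derivative_eval_ne_zero_of_exp_lt`).
By Hurwitz, a zero of `C` then forces `C` to vanish on a component of the complement. That component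
is unbounded by polynomial convexity, while `z C(z) → 1` at infinity.

The level `c` is found from two facts on the potential: it is at most `I` on `K`, uniformly after
truncation (`IsEquilibriumMeasure.potential_bounds`), and greater than `I` at every point off `K`
(`lt_truncPotential_of_notMem`). The first compares `ω` with a measure spread radially over `K`,
which meets every small circle about each of its points. The second is a maximum principle argument
with a polynomial that separates the point from `K`. -/

namespace RootSparse

/-! ### Logarithmic kernel and mutual energy -/

/-- The nonnegative kernel `log (R / |z - w|)`, infinite on the diagonal. -/
noncomputable def logKernel (R : ℝ) (z w : ℂ) : ℝ≥0∞ :=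
  open Classical in if z = w then ⊤ else ENNReal.ofReal (Real.log R - Real.log ‖z - w‖)

lemma logKernel_self (R : ℝ) (z : ℂ) : logKernel R z z = ⊤ := by simp [logKernel]

lemma logKernel_of_ne {R : ℝ} {z w : ℂ} (h : z ≠ w) :
    logKernel R z w = ENNReal.ofReal (Real.log R - Real.log ‖z - w‖) := by simp [logKernel, h]

lemma logKernel_comm (R : ℝ) (z w : ℂ) : logKernel R z w = logKernel R w z := by
  by_cases h : z = w
  · rw [h]
  · rw [logKernel_of_ne h, logKernel_of_ne (Ne.symm h), norm_sub_rev]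

lemma measurable_logKernel (R : ℝ) : Measurable (Function.uncurry (logKernel R)) := by
  classical
  have : Function.uncurry (logKernel R) = fun p : ℂ × ℂ => if p.1 = p.2 then ⊤ else
      ENNReal.ofReal (Real.log R - Real.log ‖p.1 - p.2‖) := by
    ext ⟨z, w⟩; simp [logKernel]
  rw [this]
  refine Measurable.ite ?_ measurable_const (by fun_prop)
  exact measurableSet_diagonal

/-- The mutual energy of two measures for `logKernel R`. -/
noncomputable def kernelEnergy (R : ℝ) (μ ν : Measure ℂ) : ℝ≥0∞ :=
  ∫⁻ z, ∫⁻ w, logKernel R z w ∂ν ∂μ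

lemma kernelEnergy_comm (R : ℝ) (μ ν : Measure ℂ) [SFinite μ] [SFinite ν] :
    kernelEnergy R μ ν = kernelEnergy R ν μ := by
  unfold kernelEnergy
  rw [lintegral_lintegral_swap (measurable_logKernel R).aemeasurable]
  simp only [logKernel_comm R]

lemma measurable_lintegral_logKernel (R : ℝ) (ν : Measure ℂ) [SFinite ν] :
    Measurable fun z => ∫⁻ w, logKernel R z w ∂ν :=
  (measurable_logKernel R).lintegral_prod_right'

lemma kernelEnergy_convexComb (R : ℝ) (ω ν : Measure ℂ) [SFinite ω] [SFinite ν] (a b : ℝ≥0∞) :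
    kernelEnergy R (a • ω + b • ν) (a • ω + b • ν) =
      a * (a * kernelEnergy R ω ω) + 2 * (a * (b * kernelEnergy R ν ω)) +
        b * (b * kernelEnergy R ν ν) := by
  have h := kernelEnergy_comm R ω ν
  unfold kernelEnergy at *
  simp only [lintegral_add_measure, lintegral_smul_measure, smul_eq_mul]
  rw [lintegral_add_left, lintegral_add_left, lintegral_const_mul, lintegral_const_mul,
    lintegral_const_mul, lintegral_const_mul, h]
  · ring
  all_goals first
    | exact measurable_lintegral_logKernel R _
    | exact (measurable_lintegral_logKernel R _).const_mul _

lemma toENNReal_log_of_ne {z w : ℂ} (h : z ≠ w) :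
    (ENNReal.log ‖z - w‖ₑ).toENNReal = ENNReal.ofReal (Real.log ‖z - w‖) ∧
    (-ENNReal.log ‖z - w‖ₑ).toENNReal = ENNReal.ofReal (-Real.log ‖z - w‖) := by
  have hp : 0 < ‖z - w‖ := norm_pos_iff.2 (sub_ne_zero.2 h)
  rw [← ofReal_norm, ENNReal.log_ofReal_of_pos hp]
  exact ⟨EReal.real_coe_toENNReal _, by rw [← EReal.coe_neg]; exact EReal.real_coe_toENNReal _⟩

/-- The additive form avoids subtraction in `ℝ≥0∞`; on the diagonal both sides are `⊤`. Taking `R ≥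
1` keeps `log R` nonnegative. -/
lemma neg_log_add_eq_logKernel_add {R : ℝ} (hR : 1 ≤ R) {z w : ℂ} (h : ‖z - w‖ ≤ R) :
    (-ENNReal.log ‖z - w‖ₑ).toENNReal + ENNReal.ofReal (Real.log R) =
      logKernel R z w + (ENNReal.log ‖z - w‖ₑ).toENNReal := by
  by_cases hzw : z = w
  · subst hzw
    simp [logKernel_self]
  · have hp : 0 < ‖z - w‖ := norm_pos_iff.2 (sub_ne_zero.2 hzw)
    rw [(toENNReal_log_of_ne hzw).1, (toENNReal_log_of_ne hzw).2, logKernel_of_ne hzw]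
    have h1 : 0 ≤ Real.log R := Real.log_nonneg hR
    have h2 : Real.log ‖z - w‖ ≤ Real.log R := Real.log_le_log hp h
    rcases le_total 0 (Real.log ‖z - w‖) with h0 | h0
    · rw [ENNReal.ofReal_of_nonpos (by linarith : -Real.log ‖z - w‖ ≤ 0), zero_add,
        ← ENNReal.ofReal_add (by linarith) h0]
      congr 1; ring
    · rw [ENNReal.ofReal_of_nonpos h0, add_zero, ← ENNReal.ofReal_add (by linarith) h1]
      congr 1; ring

/-! ### Variational inequality for the equilibrium measure -/

section compact

variable {K : Set ℂ} {R : ℝ}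

lemma lintegral_neg_log_add (hR : 1 ≤ R) (hKR : ∀ z ∈ K, ∀ w ∈ K, ‖z - w‖ ≤ R)
    {μ : Measure ℂ} [IsProbabilityMeasure μ] (hμ : μ Kᶜ = 0) :
    (∫⁻ z, ∫⁻ w, (-ENNReal.log ‖z - w‖ₑ).toENNReal ∂μ ∂μ) + ENNReal.ofReal (Real.log R) =
      kernelEnergy R μ μ + ∫⁻ z, ∫⁻ w, (ENNReal.log ‖z - w‖ₑ).toENNReal ∂μ ∂μ := by
  have hK : ∀ᵐ z ∂μ, z ∈ K := mem_ae_iff.2 hμ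
  unfold kernelEnergy
  rw [← lintegral_add_left (measurable_lintegral_logKernel R μ)]
  have : ENNReal.ofReal (Real.log R) = ∫⁻ _ : ℂ, ENNReal.ofReal (Real.log R) ∂μ := by simp
  rw [this, ← lintegral_add_right _ measurable_const]
  refine lintegral_congr_ae ?_
  filter_upwards [hK] with z hz
  have : ENNReal.ofReal (Real.log R) = ∫⁻ _ : ℂ, ENNReal.ofReal (Real.log R) ∂μ := by simp
  rw [this, ← lintegral_add_right _ measurable_const,
    ← lintegral_add_left ((measurable_logKernel R).of_uncurry_left)]
  refine lintegral_congr_ae ?_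
  filter_upwards [hK] with w hw
  exact neg_log_add_eq_logKernel_add hR (hKR z hz w hw)

lemma lintegral_pos_log_lt_top (hKR : ∀ z ∈ K, ∀ w ∈ K, ‖z - w‖ ≤ R)
    {μ : Measure ℂ} [IsProbabilityMeasure μ] (hμ : μ Kᶜ = 0) :
    (∫⁻ z, ∫⁻ w, (ENNReal.log ‖z - w‖ₑ).toENNReal ∂μ ∂μ) < ⊤ := by
  have hK : ∀ᵐ z ∂μ, z ∈ K := mem_ae_iff.2 hμ
  calc _ ≤ ∫⁻ _ : ℂ, ∫⁻ _ : ℂ, ENNReal.ofReal (Real.log R) ∂μ ∂μ := by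
        refine lintegral_mono_ae ?_
        filter_upwards [hK] with z hz
        refine lintegral_mono_ae ?_
        filter_upwards [hK] with w hw
        by_cases hzw : z = w
        · simp [hzw]
        · rw [(toENNReal_log_of_ne hzw).1]
          exact ENNReal.ofReal_le_ofReal (Real.log_le_log
            (norm_pos_iff.2 (sub_ne_zero.2 hzw)) (hKR z hz w hw))
    _ < ⊤ := by simp

/-- The positive part of the logarithm has finite integral, so `lintegral_neg_log_add` identifies
the logarithmic energy with `log R` minus the kernel energy. Maximizing the one is minimizing the
other. -/
lemma IsEquilibriumMeasure.kernelEnergy_le (hR : 1 ≤ R)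
    (hKR : ∀ z ∈ K, ∀ w ∈ K, ‖z - w‖ ≤ R) {ω : Measure ℂ} (hω : IsEquilibriumMeasure ω K)
    {μ : Measure ℂ} [IsProbabilityMeasure μ] (hμ : μ Kᶜ = 0) :
    kernelEnergy R ω ω ≤ kernelEnergy R μ μ := by
  obtain ⟨hp, hωK, hmax⟩ := hω
  have h := hmax μ inferInstance hμ
  have e1 := lintegral_neg_log_add hR hKR hμ
  have e2 := lintegral_neg_log_add hR hKR hωK
  have f1 := lintegral_pos_log_lt_top hKR hμ
  have f2 := lintegral_pos_log_lt_top hKR hωK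
  unfold logEnergy at h
  by_cases hE : kernelEnergy R μ μ = ⊤
  · simp [hE]
  generalize kernelEnergy R μ μ = E at *
  generalize kernelEnergy R ω ω = E' at *
  generalize (∫⁻ z, ∫⁻ w, (-ENNReal.log ‖z - w‖ₑ).toENNReal ∂μ ∂μ) = N at *
  generalize (∫⁻ z, ∫⁻ w, (-ENNReal.log ‖z - w‖ₑ).toENNReal ∂ω ∂ω) = N' at *
  generalize (∫⁻ z, ∫⁻ w, (ENNReal.log ‖z - w‖ₑ).toENNReal ∂μ ∂μ) = P at *
  generalize (∫⁻ z, ∫⁻ w, (ENNReal.log ‖z - w‖ₑ).toENNReal ∂ω ∂ω) = P' at *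
  have hN : N ≠ ⊤ := by
    rintro rfl
    rw [top_add] at e1
    exact (ENNReal.add_lt_top.2 ⟨lt_top_iff_ne_top.2 hE, f1⟩).ne e1.symm
  lift P to NNReal using f1.ne
  lift P' to NNReal using f2.ne
  lift N to NNReal using hN
  lift E to NNReal using hE
  have hN' : N' ≠ ⊤ := by
    rintro rfl
    have h3 : ((P : ℝ≥0∞) : EReal) - ((N : ℝ≥0∞) : EReal) = ((P : ℝ) - (N : ℝ) : ℝ) := by
      rw [EReal.coe_sub]; rfl
    have h4 : (((P' : ℝ≥0∞) : EReal)) - ((⊤ : ℝ≥0∞) : EReal) = ⊥ := by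
      rw [EReal.coe_ennreal_top, EReal.sub_top]
    rw [h3, h4] at h
    exact EReal.coe_ne_bot _ (le_bot_iff.1 h)
  lift N' to NNReal using hN'
  have hE' : E' ≠ ⊤ := by
    rintro rfl
    rw [top_add] at e2
    exact (ENNReal.add_lt_top.2 ⟨ENNReal.coe_lt_top, ENNReal.ofReal_lt_top⟩).ne e2
  lift E' to NNReal using hE'
  have h5 : (P : ℝ) - N ≤ P' - N' := by
    have h3 : ∀ a b : NNReal, ((a : ℝ≥0∞) : EReal) - ((b : ℝ≥0∞) : EReal) =
        ((a : ℝ) - (b : ℝ) : ℝ) := fun a b => by rw [EReal.coe_sub]; rfl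
    rw [h3, h3] at h
    exact_mod_cast h
  have g1 := congrArg ENNReal.toReal e1
  have g2 := congrArg ENNReal.toReal e2
  rw [ENNReal.toReal_add (by simp) (by simp), ENNReal.toReal_add (by simp) (by simp)] at g1 g2
  simp only [ENNReal.coe_toReal] at g1 g2
  have : (E' : ℝ) ≤ E := by linarith
  exact_mod_cast this

/-- First variation: the energy of `(1 - t) ω + t ν` is minimal at `t = 0`, where its one-sided
derivative is twice the mutual energy minus the energy of `ω`. Finite energy of `ν` makes the
quadratic coefficient finite. -/
lemma IsEquilibriumMeasure.kernelEnergy_le_mutual (hR : 1 ≤ R)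
    (hKR : ∀ z ∈ K, ∀ w ∈ K, ‖z - w‖ ≤ R) {ω : Measure ℂ} (hω : IsEquilibriumMeasure ω K)
    {ν : Measure ℂ} [IsProbabilityMeasure ν] (hν : ν Kᶜ = 0) (hfin : kernelEnergy R ν ν ≠ ⊤) :
    kernelEnergy R ω ω ≤ kernelEnergy R ν ω := by
  have := hω.1
  have hωfin : kernelEnergy R ω ω ≠ ⊤ :=
    ne_top_of_le_ne_top hfin (hω.kernelEnergy_le hR hKR hν)
  by_contra! hlt
  have hx : kernelEnergy R ν ω ≠ ⊤ := hlt.ne_top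
  have key : ∀ t : ℝ, 0 ≤ t → t ≤ 1 → (kernelEnergy R ω ω).toReal ≤
      (1 - t) * ((1 - t) * (kernelEnergy R ω ω).toReal) +
        2 * ((1 - t) * (t * (kernelEnergy R ν ω).toReal)) +
        t * (t * (kernelEnergy R ν ν).toReal) := by
    intro t h0 h1
    set a := ENNReal.ofReal (1 - t)
    set b := ENNReal.ofReal t
    have hab : a + b = 1 := by
      rw [← ENNReal.ofReal_add (by linarith) h0]; simp
    have hprob : IsProbabilityMeasure (a • ω + b • ν) := ⟨by simp [hab]⟩
    have hnull : (a • ω + b • ν) Kᶜ = 0 := by simp [hω.2.1, hν]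
    have h := hω.kernelEnergy_le hR hKR hnull
    rw [kernelEnergy_convexComb] at h
    have ha : a.toReal = 1 - t := ENNReal.toReal_ofReal (by linarith)
    have hb : b.toReal = t := ENNReal.toReal_ofReal h0
    have ha' : a ≠ ⊤ := ENNReal.ofReal_ne_top
    have hb' : b ≠ ⊤ := ENNReal.ofReal_ne_top
    have h' := ENNReal.toReal_mono (by finiteness) h
    rw [ENNReal.toReal_add (by finiteness) (by finiteness),
      ENNReal.toReal_add (by finiteness) (by finiteness)] at h'
    simpa [ENNReal.toReal_mul, ha, hb] using h'
  have hlt' := (ENNReal.toReal_lt_toReal hx hωfin).2 hlt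
  generalize (kernelEnergy R ω ω).toReal = e at *
  generalize (kernelEnergy R ν ω).toReal = x at *
  have hv : 0 ≤ (kernelEnergy R ν ν).toReal := ENNReal.toReal_nonneg
  generalize (kernelEnergy R ν ν).toReal = v at *
  have hd : 0 < e - x := by linarith
  -- With `t = (e - x) / D` one has `t ≤ 1`, and the quadratic term is at most `t * (e - x)`, too
  -- small to offset the linear gain `2 * t * (e - x)`.
  set D := |v + e - 2 * x| + (e - x) + 1 with hD
  have hDpos : 0 < D := by positivity
  have ht0 : 0 < (e - x) / D := by positivity
  have ht1 : (e - x) / D ≤ 1 := by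
    rw [div_le_one hDpos]; have := abs_nonneg (v + e - 2 * x); linarith
  have h := key _ ht0.le ht1
  set t := (e - x) / D with ht
  have htD : t * D = e - x := by rw [ht]; field_simp
  have h2 : t * (2 * (e - x)) ≤ t * (t * (v + e - 2 * x)) := by nlinarith
  have h3 := le_of_mul_le_mul_left h2 ht0
  have h4 : t * (v + e - 2 * x) ≤ t * D :=
    mul_le_mul_of_nonneg_left (by have := le_abs_self (v + e - 2 * x); linarith) ht0.le
  linarith

end compact

/-! ### Measures spread radially over a connected set -/

/-- A connected set containing `a` and a point at distance at least `r` meets each circle of radius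
`r * s` about `a`; the point with least argument is chosen. The image of Lebesgue measure on `[0,
1]` under `σ` is the competitor against which `ω` is tested. -/
lemma exists_measurable_radial_selection {K : Set ℂ} (hK : IsCompact K) (hc : IsPreconnected K)
    {a b : ℂ} (ha : a ∈ K) (hb : b ∈ K) {r : ℝ} (hr : 0 ≤ r) (hab : r ≤ ‖b - a‖) :
    ∃ σ : ℝ → ℂ, Measurable σ ∧ ∀ s ∈ Set.Icc (0 : ℝ) 1, σ s ∈ K ∧ ‖σ s - a‖ = r * s := by
  set c : ℝ → ℝ := fun s => max 0 (min s 1) with hcdef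
  have hcc : Continuous c := by fun_prop
  have hc01 : ∀ s, c s ∈ Set.Icc (0 : ℝ) 1 := fun s => ⟨le_max_left _ _,
    max_le zero_le_one (min_le_right _ _)⟩
  have hcid : ∀ s ∈ Set.Icc (0 : ℝ) 1, c s = s := fun s hs => by
    simp [hcdef, hs.1, hs.2]
  set e : ℝ × ℝ → ℂ := fun p => a + ((r * p.1 : ℝ) : ℂ) * Complex.exp (p.2 * Complex.I) with he
  have hec : Continuous e := by fun_prop
  set T : ℝ → Set ℝ := fun s => {θ | θ ∈ Set.Icc (-Real.pi) Real.pi ∧ e (c s, θ) ∈ K} with hT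
  have hTc : ∀ s, IsCompact (T s) := fun s =>
    isCompact_Icc.inter_right (hK.isClosed.preimage (hec.comp (by fun_prop : Continuous fun θ : ℝ => (c s, θ))))
  have hTne : ∀ s, (T s).Nonempty := by
    intro s
    have h1 : r * c s ∈ Set.Icc ‖a - a‖ ‖b - a‖ := by
      have := hc01 s
      refine ⟨by simpa using mul_nonneg hr this.1, ?_⟩
      calc r * c s ≤ r * 1 := mul_le_mul_of_nonneg_left this.2 hr
        _ ≤ _ := by simpa using hab
    obtain ⟨x, hx, hxr⟩ := hc.intermediate_value ha hb
      (by fun_prop : ContinuousOn (fun x : ℂ => ‖x - a‖) K) h1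
    refine ⟨(x - a).arg, ⟨(Complex.neg_pi_lt_arg _).le, Complex.arg_le_pi _⟩, ?_⟩
    have : e (c s, (x - a).arg) = x := by
      simp only [he]
      rw [← hxr]
      simp [Complex.norm_mul_exp_arg_mul_I]
    rwa [this]
  have hmem : ∀ s, sInf (T s) ∈ T s := fun s => (hTc s).sInf_mem (hTne s)
  -- The infimum is attained, so it is at most `t` exactly when `c s` lies in the projection of a
  -- compact set; the sublevel sets are therefore closed.
  have hmeas : Measurable fun s => sInf (T s) := by
    refine measurable_of_Iic fun t => ?_
    have hset : (fun s => sInf (T s)) ⁻¹' Set.Iic t =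
        c ⁻¹' (Prod.fst '' ((Set.Icc (0 : ℝ) 1 ×ˢ Set.Icc (-Real.pi) Real.pi) ∩
          (e ⁻¹' K ∩ Prod.snd ⁻¹' Set.Iic t))) := by
      ext s
      constructor
      · intro hs
        exact ⟨(c s, sInf (T s)), ⟨⟨hc01 s, (hmem s).1⟩, (hmem s).2, hs⟩, rfl⟩
      · rintro ⟨⟨s', θ⟩, ⟨⟨_, hθ⟩, hθK, hθt⟩, hs'⟩
        simp only at hs'
        subst hs'
        exact (csInf_le (hTc s).bddBelow ⟨hθ, hθK⟩).trans hθt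
    rw [hset]
    refine (IsClosed.preimage hcc (IsCompact.isClosed ?_)).measurableSet
    refine IsCompact.image (IsCompact.inter_right (isCompact_Icc.prod isCompact_Icc) ?_)
      continuous_fst
    exact (hK.isClosed.preimage hec).inter (isClosed_Iic.preimage continuous_snd)
  refine ⟨fun s => e (c s, sInf (T s)), ?_, fun s hs => ⟨(hmem s).2, ?_⟩⟩
  · exact hec.measurable.comp (hcc.measurable.prodMk hmeas)
  · simp only [he, hcid s hs]
    rw [add_sub_cancel_left, norm_mul, Complex.norm_exp_ofReal_mul_I, mul_one, Complex.norm_real,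
      Real.norm_of_nonneg (mul_nonneg hr hs.1)]

lemma lintegral_ofReal_neg_log_abs_lt_top : ∫⁻ u : ℝ, ENNReal.ofReal (-Real.log |u|) < ⊤ := by
  have h1 : IntegrableOn Real.log (Set.Ioc (-1) 1) volume :=
    (intervalIntegrable_iff_integrableOn_Ioc_of_le (by norm_num)).1
      intervalIntegral.intervalIntegrable_log'
  have h2 := h1.hasFiniteIntegral
  calc ∫⁻ u : ℝ, ENNReal.ofReal (-Real.log |u|)
      ≤ ∫⁻ u : ℝ, (Set.Icc (-1 : ℝ) 1).indicator (fun u => ‖Real.log u‖ₑ) u := by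
        refine lintegral_mono fun u => ?_
        by_cases hu : u ∈ Set.Icc (-1 : ℝ) 1
        · rw [Set.indicator_of_mem hu, Real.log_abs, Real.enorm_eq_ofReal_abs]
          exact ENNReal.ofReal_le_ofReal (neg_le_abs _)
        · rw [Set.indicator_of_notMem hu, nonpos_iff_eq_zero]
          refine ENNReal.ofReal_of_nonpos ?_
          have : 1 ≤ |u| := by
            by_contra! h
            exact hu ⟨(abs_lt.1 h).1.le, (abs_lt.1 h).2.le⟩
          linarith [Real.log_nonneg this]
    _ = ∫⁻ u in Set.Ioc (-1 : ℝ) 1, ‖Real.log u‖ₑ := by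
        rw [lintegral_indicator measurableSet_Icc]
        exact setLIntegral_congr Ioc_ae_eq_Icc.symm
    _ < ⊤ := h2

lemma neg_log_one_sub_inv_le {A : ℝ} (hA : 2 ≤ A) : -Real.log (1 - 1 / A) ≤ 2 / A := by
  have h : 1 / A ≤ 1 / 2 := one_div_le_one_div_of_le (by norm_num) hA
  have h0 : 0 < 1 - 1 / A := by linarith
  have h1 := Real.one_sub_inv_le_log_of_pos h0
  have h2 : (1 - 1 / A)⁻¹ ≤ 1 + 2 / A := by
    rw [inv_le_iff_one_le_mul₀ h0]
    have : 0 < 1 / A := by positivity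
    have e : 2 / A = 2 * (1 / A) := by ring
    rw [e]; nlinarith
  linarith

section selection

variable {σ : ℝ → ℂ} {a : ℂ} {r R : ℝ}

/-- Only distances to `a` are compared: `|σ s - w| ≥ | |σ s - a| - |w - a| | = r |s - τ|`. The bound
is uniform in `w` because the singularity `-log |s - τ|` is integrable on the line. -/
lemma lintegral_logKernel_radial_le (hr : 0 < r)
    (hσ : ∀ s ∈ Set.Icc (0 : ℝ) 1, ‖σ s - a‖ = r * s) (w : ℂ) :
    ∫⁻ s in Set.Icc (0 : ℝ) 1, logKernel R (σ s) w ≤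
      ENNReal.ofReal (Real.log R - Real.log r) + ∫⁻ u : ℝ, ENNReal.ofReal (-Real.log |u|) := by
  set τ := ‖w - a‖ / r with hτ
  have hwa : ‖w - a‖ = r * τ := by rw [hτ]; field_simp
  calc ∫⁻ s in Set.Icc (0 : ℝ) 1, logKernel R (σ s) w
      ≤ ∫⁻ s in Set.Icc (0 : ℝ) 1, (ENNReal.ofReal (Real.log R - Real.log r) +
          ENNReal.ofReal (-Real.log |s - τ|)) := by
        refine lintegral_mono_ae ?_
        have h0 : ∀ᵐ s : ℝ ∂(volume.restrict (Set.Icc (0 : ℝ) 1)), s ≠ τ :=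
          ae_restrict_of_ae (Measure.ae_ne volume τ)
        filter_upwards [h0, ae_restrict_mem measurableSet_Icc] with s hs hsI
        have hle : r * |s - τ| ≤ ‖σ s - w‖ := by
          have := abs_norm_sub_norm_le (σ s - a) (w - a)
          rw [hσ s hsI, hwa, ← mul_sub, abs_mul, abs_of_pos hr] at this
          simpa using this
        have hpos : 0 < r * |s - τ| := mul_pos hr (abs_pos.2 (sub_ne_zero.2 hs))
        have hne : σ s ≠ w := fun h => by rw [h, sub_self, norm_zero] at hle; linarith
        rw [logKernel_of_ne hne]
        refine le_trans (ENNReal.ofReal_le_ofReal ?_) ENNReal.ofReal_add_le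
        have := Real.log_le_log hpos hle
        rw [Real.log_mul hr.ne' (abs_pos.2 (sub_ne_zero.2 hs)).ne'] at this
        linarith
    _ = ENNReal.ofReal (Real.log R - Real.log r) +
          ∫⁻ s in Set.Icc (0 : ℝ) 1, ENNReal.ofReal (-Real.log |s - τ|) := by
        rw [lintegral_add_left measurable_const]; simp
    _ ≤ _ := by
        refine add_le_add le_rfl ((setLIntegral_le_lintegral _ _).trans_eq ?_)
        exact lintegral_sub_right_eq_self (fun u => ENNReal.ofReal (-Real.log |u|)) τ

/-- Seen from distance at least `A * r`, the spread measure acts like a point mass at `a`, since `|σ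
s - w| ≥ (1 - 1 / A) |w - a|`. -/
lemma lintegral_logKernel_radial_le_of_far (hr : 0 < r)
    (hσ : ∀ s ∈ Set.Icc (0 : ℝ) 1, ‖σ s - a‖ = r * s) {A : ℝ} (hA : 2 ≤ A) {w : ℂ}
    (hw : A * r ≤ ‖w - a‖) :
    ∫⁻ s in Set.Icc (0 : ℝ) 1, logKernel R (σ s) w ≤
      ENNReal.ofReal (Real.log R - Real.log ‖w - a‖) + ENNReal.ofReal (2 / A) := by
  calc ∫⁻ s in Set.Icc (0 : ℝ) 1, logKernel R (σ s) w
      ≤ ∫⁻ s in Set.Icc (0 : ℝ) 1, (ENNReal.ofReal (Real.log R - Real.log ‖w - a‖) +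
          ENNReal.ofReal (2 / A)) := by
        refine setLIntegral_mono' measurableSet_Icc fun s hs => ?_
        have hA0 : 0 < A := by linarith
        have hwpos : 0 < ‖w - a‖ := lt_of_lt_of_le (by positivity) hw
        have h1 : 1 / A ≤ 1 / 2 := one_div_le_one_div_of_le (by norm_num) hA
        have hle : ‖w - a‖ * (1 - 1 / A) ≤ ‖σ s - w‖ := by
          have h2 := norm_sub_norm_le (w - a) (σ s - a)
          rw [hσ s hs, sub_sub_sub_cancel_right, norm_sub_rev w (σ s)] at h2
          have h3 : r * s ≤ ‖w - a‖ * (1 / A) := by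
            calc r * s ≤ r * 1 := mul_le_mul_of_nonneg_left hs.2 hr.le
              _ = A * r * (1 / A) := by field_simp
              _ ≤ _ := mul_le_mul_of_nonneg_right hw (by positivity)
          nlinarith
        have hpos : 0 < ‖w - a‖ * (1 - 1 / A) := mul_pos hwpos (by linarith)
        have hne : σ s ≠ w := fun h => by rw [h, sub_self, norm_zero] at hle; linarith
        rw [logKernel_of_ne hne]
        refine le_trans (ENNReal.ofReal_le_ofReal ?_) ENNReal.ofReal_add_le
        have h4 := Real.log_le_log hpos hle
        rw [Real.log_mul hwpos.ne' (by linarith)] at h4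
        linarith [neg_log_one_sub_inv_le hA]
    _ = _ := by simp

end selection

/-- A measure of finite energy charges small discs uniformly little. -/
lemma exists_measureReal_closedBall_le {ω : Measure ℂ} {R : ℝ} (hR : 0 < R) (hfin : kernelEnergy R ω ω ≠ ⊤)
    {ε : ℝ} (hε : 0 < ε) : ∃ ρ > 0, ∀ z, ω.real (Metric.closedBall z ρ) ≤ ε := by
  set E := (kernelEnergy R ω ω).toReal with hE
  have hE0 : 0 ≤ E := ENNReal.toReal_nonneg
  -- On a disc of radius `ρ` the kernel is at least `log (R / (2ρ)) = (E + 1) / ε ^ 2`, so mass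
  -- above `ε` would force energy at least `E + 1`.
  set ρ := R / 2 * Real.exp (-((E + 1) / ε ^ 2)) with hρ
  have hρ0 : 0 < ρ := by positivity
  have hlog : Real.log R - Real.log (2 * ρ) = (E + 1) / ε ^ 2 := by
    have : 2 * ρ = R * Real.exp (-((E + 1) / ε ^ 2)) := by rw [hρ]; ring
    rw [this, Real.log_mul hR.ne' (Real.exp_pos _).ne', Real.log_exp]; ring
  refine ⟨ρ, hρ0, fun z => ?_⟩
  by_contra! hlt
  set B := Metric.closedBall z ρ
  have h1 : ω B * (ω B * ENNReal.ofReal ((E + 1) / ε ^ 2)) ≤ kernelEnergy R ω ω := by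
    calc ω B * (ω B * ENNReal.ofReal ((E + 1) / ε ^ 2))
        = ∫⁻ _ in B, ∫⁻ _ in B, ENNReal.ofReal ((E + 1) / ε ^ 2) ∂ω ∂ω := by
          simp [mul_comm]
      _ ≤ ∫⁻ x in B, ∫⁻ w in B, logKernel R x w ∂ω ∂ω := by
          refine setLIntegral_mono' Metric.isClosed_closedBall.measurableSet fun x hx => ?_
          refine setLIntegral_mono' Metric.isClosed_closedBall.measurableSet fun w hw => ?_
          by_cases hxw : x = w
          · rw [hxw, logKernel_self]; exact le_top
          · rw [logKernel_of_ne hxw]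
            refine ENNReal.ofReal_le_ofReal ?_
            have : ‖x - w‖ ≤ 2 * ρ := by
              rw [← dist_eq_norm]
              have := dist_triangle_right x w z
              have h1 := Metric.mem_closedBall.1 hx
              have h2 := Metric.mem_closedBall.1 hw
              linarith
            have := Real.log_le_log (norm_pos_iff.2 (sub_ne_zero.2 hxw)) this
            linarith
      _ ≤ ∫⁻ x in B, ∫⁻ w, logKernel R x w ∂ω ∂ω :=
          lintegral_mono fun x => setLIntegral_le_lintegral _ _
      _ ≤ _ := setLIntegral_le_lintegral _ _
  have h2 := ENNReal.toReal_mono hfin h1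
  rw [ENNReal.toReal_mul, ENNReal.toReal_mul, ENNReal.toReal_ofReal (by positivity)] at h2
  change ω.real B * (ω.real B * _) ≤ E at h2
  have h3 : ε * (ε * ((E + 1) / ε ^ 2)) ≤ ω.real B * (ω.real B * ((E + 1) / ε ^ 2)) := by
    gcongr
  have h4 : ε * (ε * ((E + 1) / ε ^ 2)) = E + 1 := by field_simp
  linarith

/-! ### Truncated logarithmic potentials -/

section potential

variable {K : Set ℂ} {ω : Measure ℂ} [IsProbabilityMeasure ω]

lemma integrable_of_continuousOn {E : Type*} [NormedAddCommGroup E] (hK : IsCompact K)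
    (hωK : ω Kᶜ = 0) {f : ℂ → E} (hf : ContinuousOn f K) : Integrable f ω := by
  have := hf.integrableOn_compact (μ := ω) hK
  rwa [IntegrableOn, Measure.restrict_eq_self_of_ae_mem (mem_ae_iff.2 hωK)] at this

/-- The logarithmic potential with the kernel truncated at distance `δ`. -/
noncomputable def truncPotential (ω : Measure ℂ) (δ : ℝ) (z : ℂ) : ℝ :=
  ∫ w, Real.log (max ‖z - w‖ δ) ∂ω

lemma continuous_log_max {δ : ℝ} (hδ : 0 < δ) :
    Continuous fun p : ℂ × ℂ => Real.log (max ‖p.1 - p.2‖ δ) :=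
  Continuous.log (by fun_prop) fun p => (lt_of_lt_of_le hδ (le_max_right _ _)).ne'

lemma integrable_log_max (hK : IsCompact K) (hωK : ω Kᶜ = 0) {δ : ℝ} (hδ : 0 < δ) (z : ℂ) :
    Integrable (fun w => Real.log (max ‖z - w‖ δ)) ω :=
  integrable_of_continuousOn hK hωK
    ((continuous_log_max hδ).comp (by fun_prop : Continuous fun w : ℂ => (z, w))).continuousOn

lemma log_sub_log_le {a b : ℝ} (ha : 0 < a) (hb : 0 < b) : Real.log a - Real.log b ≤ (a - b) / b := by
  have := Real.log_le_sub_one_of_pos (div_pos ha hb)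
  rw [Real.log_div ha.ne' hb.ne'] at this
  rwa [sub_div, div_self hb.ne']

/-- The Lipschitz constant `1 / δ` does not depend on `w`. It passes to potentials and to averages
over roots, and later turns pointwise convergence into uniform convergence. -/
lemma log_max_sub_le {δ : ℝ} (hδ : 0 < δ) (z z' w : ℂ) :
    Real.log (max ‖z - w‖ δ) - Real.log (max ‖z' - w‖ δ) ≤ ‖z - z'‖ / δ := by
  have h1 : 0 < max ‖z - w‖ δ := lt_of_lt_of_le hδ (le_max_right _ _)
  have h2 : 0 < max ‖z' - w‖ δ := lt_of_lt_of_le hδ (le_max_right _ _)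
  refine (log_sub_log_le h1 h2).trans ?_
  have h3 : max ‖z - w‖ δ - max ‖z' - w‖ δ ≤ ‖z - z'‖ := by
    have h4 : ‖z - w‖ ≤ ‖z - z'‖ + ‖z' - w‖ := by
      simpa using norm_add_le (z - z') (z' - w)
    have h5 := le_max_left ‖z' - w‖ δ
    have h6 := le_max_right ‖z' - w‖ δ
    have h7 := norm_nonneg (z - z')
    rw [sub_le_iff_le_add]
    exact max_le (by linarith) (by linarith)
  calc _ ≤ ‖z - z'‖ / max ‖z' - w‖ δ := div_le_div_of_nonneg_right h3 h2.le
    _ ≤ _ := div_le_div_of_nonneg_left (norm_nonneg _) hδ (le_max_right _ _)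

lemma truncPotential_sub_le (hK : IsCompact K) (hωK : ω Kᶜ = 0) {δ : ℝ} (hδ : 0 < δ) (z z' : ℂ) :
    truncPotential ω δ z - truncPotential ω δ z' ≤ ‖z - z'‖ / δ := by
  unfold truncPotential
  rw [← integral_sub (integrable_log_max hK hωK hδ z) (integrable_log_max hK hωK hδ z')]
  calc _ ≤ ∫ _ : ℂ, ‖z - z'‖ / δ ∂ω := integral_mono
        ((integrable_log_max hK hωK hδ z).sub (integrable_log_max hK hωK hδ z'))
        (integrable_const _) (log_max_sub_le hδ z z')
    _ = _ := by simp

lemma continuous_truncPotential (hK : IsCompact K) (hωK : ω Kᶜ = 0) {δ : ℝ} (hδ : 0 < δ) :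
    Continuous (truncPotential ω δ) := by
  have : LipschitzWith (Real.toNNReal (1 / δ)) (truncPotential ω δ) := by
    refine LipschitzWith.of_dist_le_mul fun z z' => ?_
    rw [Real.coe_toNNReal _ (by positivity), Real.dist_eq, abs_le, dist_eq_norm]
    have h1 := truncPotential_sub_le hK hωK hδ z z'
    have h2 := truncPotential_sub_le hK hωK hδ z' z
    rw [norm_sub_rev] at h2
    rw [div_mul_eq_mul_div, one_mul]
    constructor <;> linarith
  exact this.continuous

lemma truncPotential_mono (hK : IsCompact K) (hωK : ω Kᶜ = 0) {δ δ' : ℝ} (hδ : 0 < δ)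
    (h : δ ≤ δ') (z : ℂ) : truncPotential ω δ z ≤ truncPotential ω δ' z :=
  integral_mono (integrable_log_max hK hωK hδ z) (integrable_log_max hK hωK (hδ.trans_le h) z)
    fun _ => Real.log_le_log (lt_of_lt_of_le hδ (le_max_right _ _)) (max_le_max le_rfl h)

end potential

/-! ### Bounds for the equilibrium potential -/

section equilibrium

variable {K : Set ℂ} {R : ℝ} {ω : Measure ℂ}

/-- The potential bound at a point of a connected set, from the comparison of the equilibrium
measure with a measure spread radially over the set near that point. -/
lemma IsEquilibriumMeasure.radial_bound (hK : IsCompact K) (hc : IsPreconnected K) (hR : 1 ≤ R)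
    (hKR : ∀ z ∈ K, ∀ w ∈ K, ‖z - w‖ ≤ R) (hω : IsEquilibriumMeasure ω K) {a b : ℂ} (ha : a ∈ K)
    (hb : b ∈ K) {r : ℝ} (hr : 0 < r) (hab : r ≤ ‖b - a‖) {A : ℝ} (hA : 2 ≤ A) :
    kernelEnergy R ω ω ≠ ⊤ ∧
    truncPotential ω r a ≤ Real.log R - (kernelEnergy R ω ω).toReal + 2 / A +
      (Real.log A + (∫⁻ u : ℝ, ENNReal.ofReal (-Real.log |u|)).toReal) *
        ω.real (Metric.closedBall a (A * r)) := by
  have := hω.1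
  have hωK := hω.2.1
  have hrR : r ≤ R := hab.trans (hKR b hb a ha)
  obtain ⟨σ, hσm, hσ⟩ := exists_measurable_radial_selection hK hc ha hb hr.le hab
  have hC0 : ∫⁻ u : ℝ, ENNReal.ofReal (-Real.log |u|) ≠ ⊤ := lintegral_ofReal_neg_log_abs_lt_top.ne
  set C0 := ∫⁻ u : ℝ, ENNReal.ofReal (-Real.log |u|) with hC0def
  set ν : Measure ℂ := Measure.map σ (volume.restrict (Set.Icc (0 : ℝ) 1)) with hν
  have hνp : IsProbabilityMeasure ν := by
    refine ⟨?_⟩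
    rw [hν, Measure.map_apply hσm MeasurableSet.univ]
    simp
  have hνK : ν Kᶜ = 0 := by
    rw [hν, Measure.map_apply hσm hK.measurableSet.compl,
      Measure.restrict_apply (hσm hK.measurableSet.compl)]
    convert measure_empty (μ := (volume : Measure ℝ))
    ext s
    simp only [Set.mem_inter_iff, Set.mem_preimage, Set.mem_compl_iff, Set.mem_empty_iff_false,
      iff_false, not_and]
    exact fun h hs => h (hσ s hs).1
  have hpot : ∀ w, ∫⁻ x, logKernel R w x ∂ν = ∫⁻ s in Set.Icc (0 : ℝ) 1, logKernel R (σ s) w := by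
    intro w
    rw [hν, lintegral_map ((measurable_logKernel R).of_uncurry_left) hσm]
    simp only [logKernel_comm R w]
  have hσn := fun s hs => (hσ s hs).2
  have hEν : kernelEnergy R ν ν ≠ ⊤ := by
    refine ne_top_of_le_ne_top (b := ENNReal.ofReal (Real.log R - Real.log r) + C0)
      (by finiteness) ?_
    calc kernelEnergy R ν ν ≤ ∫⁻ _ : ℂ, (ENNReal.ofReal (Real.log R - Real.log r) + C0) ∂ν :=
          lintegral_mono fun z => (hpot z).trans_le (lintegral_logKernel_radial_le hr hσn z)
      _ = _ := by simp
  have hE : kernelEnergy R ω ω ≠ ⊤ := ne_top_of_le_ne_top hEν (hω.kernelEnergy_le hR hKR hνK)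
  refine ⟨hE, ?_⟩
  have h1 := hω.kernelEnergy_le_mutual hR hKR hνK hEν
  rw [kernelEnergy_comm R ν ω] at h1
  have hA0 : 0 < A := by linarith
  have hlogA : 0 ≤ Real.log A := Real.log_nonneg (by linarith)
  set CA : ℝ≥0∞ := ENNReal.ofReal (Real.log A) + C0 with hCA
  have hB : MeasurableSet (Metric.closedBall a (A * r)) := Metric.isClosed_closedBall.measurableSet
  have hint := integrable_log_max hK hωK hr a
  have hKae : ∀ᵐ z ∂ω, z ∈ K := mem_ae_iff.2 hωK
  have hnn : ∀ w ∈ K, 0 ≤ Real.log R - Real.log (max ‖a - w‖ r) := fun w hw =>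
    sub_nonneg.2 (Real.log_le_log (lt_of_lt_of_le hr (le_max_right _ _))
      (max_le (hKR a ha w hw) hrR))
  -- For `w` outside the disc of radius `A * r`, `ν` is nearly a point mass at `a` and the error is
  -- `2 / A`. Inside, `max ‖a - w‖ r ≤ A * r`, so the uniform bound exceeds the truncated kernel by
  -- at most `log A + C0`, which is charged to the mass of the disc.
  have h2 : kernelEnergy R ω ν ≤ ENNReal.ofReal (Real.log R - truncPotential ω r a) +
      ENNReal.ofReal (2 / A) + CA * ω (Metric.closedBall a (A * r)) := by
    calc kernelEnergy R ω ν ≤ ∫⁻ w, (ENNReal.ofReal (Real.log R - Real.log (max ‖a - w‖ r)) +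
          ENNReal.ofReal (2 / A) +
          (Metric.closedBall a (A * r)).indicator (fun _ => CA) w) ∂ω := by
          refine lintegral_mono_ae ?_
          filter_upwards [hKae] with w hw
          rw [hpot w]
          rcases le_or_gt (A * r) ‖w - a‖ with hfar | hnear
          · refine (lintegral_logKernel_radial_le_of_far hr hσn hA hfar).trans ?_
            refine le_add_right (le_of_eq ?_)
            rw [max_eq_left, norm_sub_rev]
            rw [norm_sub_rev]
            nlinarith
          · refine (lintegral_logKernel_radial_le hr hσn w).trans ?_
            rw [Set.indicator_of_mem (by rw [Metric.mem_closedBall, dist_eq_norm]; exact hnear.le)]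
            have h3 : ENNReal.ofReal (Real.log R - Real.log r) ≤
                ENNReal.ofReal (Real.log R - Real.log (max ‖a - w‖ r)) +
                  ENNReal.ofReal (Real.log A) := by
              rw [← ENNReal.ofReal_add (hnn w hw) hlogA]
              refine ENNReal.ofReal_le_ofReal ?_
              have h4 : max ‖a - w‖ r ≤ A * r :=
                max_le (by rw [norm_sub_rev]; exact hnear.le) (by nlinarith)
              have h5 := Real.log_le_log (lt_of_lt_of_le hr (le_max_right _ _)) h4
              rw [Real.log_mul hA0.ne' hr.ne'] at h5
              linarith
            calc _ ≤ (ENNReal.ofReal (Real.log R - Real.log (max ‖a - w‖ r)) +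
                  ENNReal.ofReal (Real.log A)) + C0 := add_le_add h3 le_rfl
              _ = ENNReal.ofReal (Real.log R - Real.log (max ‖a - w‖ r)) + CA := by
                  rw [hCA, add_assoc]
              _ ≤ _ := add_le_add le_self_add le_rfl
      _ = _ := by
          rw [lintegral_add_right _ (measurable_const.indicator hB), lintegral_add_right _
            measurable_const, lintegral_indicator hB, ← ofReal_integral_eq_lintegral_ofReal]
          · rw [integral_sub (integrable_const _) hint]
            simp [truncPotential]
          · exact (integrable_const _).sub hint
          · filter_upwards [hKae] with w hw using hnn w hw
  have h3 := ENNReal.toReal_mono (by finiteness) (le_trans h1 h2)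
  have h4 : 0 ≤ Real.log R - truncPotential ω r a := by
    have : Real.log R - truncPotential ω r a =
        ∫ w, (Real.log R - Real.log (max ‖a - w‖ r)) ∂ω := by
      rw [integral_sub (integrable_const _) hint]; simp [truncPotential]
    rw [this]
    exact integral_nonneg_of_ae (by filter_upwards [hKae] with w hw using hnn w hw)
  rw [ENNReal.toReal_add (by finiteness) (by finiteness),
    ENNReal.toReal_add (by finiteness) (by finiteness), ENNReal.toReal_mul, hCA,
    ENNReal.toReal_add (by finiteness) (by finiteness), ENNReal.toReal_ofReal h4,
    ENNReal.toReal_ofReal (by positivity), ENNReal.toReal_ofReal hlogA] at h3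
  change _ ≤ _ + (_ * ω.real _) at h3
  linarith

/-- Both errors in `radial_bound` are made small uniformly on `K`: first `2 / A` by the choice of
`A`, then the disc term because finite energy limits the mass of small discs. Nontriviality gives
one admissible radius, `‖a - b‖ / 2`, for all centres. -/
lemma IsEquilibriumMeasure.truncPotential_le (hK : IsCompact K) (hc : IsPreconnected K)
    (hR : 1 ≤ R) (hKR : ∀ z ∈ K, ∀ w ∈ K, ‖z - w‖ ≤ R) (hω : IsEquilibriumMeasure ω K)
    (hnt : K.Nontrivial) : kernelEnergy R ω ω ≠ ⊤ ∧ ∀ η > 0, ∃ δ₀ > 0, ∀ δ, 0 < δ → δ ≤ δ₀ →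
      ∀ z ∈ K, truncPotential ω δ z ≤ Real.log R - (kernelEnergy R ω ω).toReal + η := by
  have := hω.1
  obtain ⟨a, ha, b, hb, hab⟩ := hnt
  have hfar : ∀ z ∈ K, ∃ c ∈ K, ‖a - b‖ / 2 ≤ ‖c - z‖ := by
    intro z hz
    by_contra! h
    have h1 := h a ha
    have h2 := h b hb
    have h3 := norm_sub_le (a - z) (b - z)
    rw [sub_sub_sub_cancel_right] at h3
    linarith
  have hr0 : 0 < ‖a - b‖ / 2 := by
    have := norm_pos_iff.2 (sub_ne_zero.2 hab); positivity
  have hE : kernelEnergy R ω ω ≠ ⊤ := by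
    obtain ⟨c, hc', hca⟩ := hfar a ha
    exact (hω.radial_bound hK hc hR hKR ha hc' hr0 hca le_rfl).1
  refine ⟨hE, fun η hη => ?_⟩
  set C0 := (∫⁻ u : ℝ, ENNReal.ofReal (-Real.log |u|)).toReal
  have hC0 : 0 ≤ C0 := ENNReal.toReal_nonneg
  set A := max 2 (4 / η) with hAdef
  have hA : 2 ≤ A := le_max_left _ _
  have hA0 : 0 < A := by linarith
  have hAη : 2 / A ≤ η / 2 := by
    rw [div_le_iff₀ hA0]
    have : 4 / η ≤ A := le_max_right _ _
    rw [div_le_iff₀ hη] at this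
    linarith
  have hCA : 0 ≤ Real.log A + C0 := add_nonneg (Real.log_nonneg (by linarith)) hC0
  obtain ⟨ρ, hρ, hball⟩ := exists_measureReal_closedBall_le (by linarith) hE
    (show 0 < η / 2 / (Real.log A + C0 + 1) by positivity)
  refine ⟨min (‖a - b‖ / 2) (ρ / A), by positivity, fun δ hδ hδ0 z hz => ?_⟩
  obtain ⟨c, hc', hcz⟩ := hfar z hz
  have h1 := (hω.radial_bound hK hc hR hKR hz hc' hδ ((hδ0.trans (min_le_left _ _)).trans hcz) hA).2
  have h2 : ω.real (Metric.closedBall z (A * δ)) ≤ η / 2 / (Real.log A + C0 + 1) := by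
    refine (measureReal_mono (Metric.closedBall_subset_closedBall ?_)).trans (hball z)
    have := hδ0.trans (min_le_right _ _)
    rw [le_div_iff₀ hA0] at this
    linarith
  have h3 : (Real.log A + C0) * ω.real (Metric.closedBall z (A * δ)) ≤ η / 2 := by
    calc _ ≤ (Real.log A + C0 + 1) * (η / 2 / (Real.log A + C0 + 1)) := by
          exact mul_le_mul (by linarith) h2 measureReal_nonneg (by linarith)
      _ = _ := by field_simp
  linarith

/-- Truncation only raises the logarithm, so the integrated truncated potential is at least the
energy `log R - kernelEnergy R ω ω`. -/
lemma le_integral_truncPotential (hK : IsCompact K) [IsProbabilityMeasure ω] (hωK : ω Kᶜ = 0)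
    (hKR : ∀ z ∈ K, ∀ w ∈ K, ‖z - w‖ ≤ R) (hE : kernelEnergy R ω ω ≠ ⊤) {δ : ℝ} (hδ : 0 < δ)
    (hδR : δ ≤ R) :
    Real.log R - (kernelEnergy R ω ω).toReal ≤ ∫ z, truncPotential ω δ z ∂ω := by
  have hKae : ∀ᵐ z ∂ω, z ∈ K := mem_ae_iff.2 hωK
  have hnn : ∀ z ∈ K, ∀ w ∈ K, 0 ≤ Real.log R - Real.log (max ‖z - w‖ δ) := fun z hz w hw =>
    sub_nonneg.2 (Real.log_le_log (lt_of_lt_of_le hδ (le_max_right _ _))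
      (max_le (hKR z hz w hw) hδR))
  have hpot : ∀ z, Real.log R - truncPotential ω δ z =
        ∫ w, (Real.log R - Real.log (max ‖z - w‖ δ)) ∂ω := fun z => by
    rw [integral_sub (integrable_const _) (integrable_log_max hK hωK hδ z)]; simp [truncPotential]
  have hint : Integrable (truncPotential ω δ) ω :=
    integrable_of_continuousOn hK hωK (continuous_truncPotential hK hωK hδ).continuousOn
  have hint' : Integrable (fun z => Real.log R - truncPotential ω δ z) ω :=
    (integrable_const _).sub hint
  have hintw : ∀ z, Integrable (fun w => Real.log R - Real.log (max ‖z - w‖ δ)) ω := fun z =>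
    (integrable_const _).sub (integrable_log_max hK hωK hδ z)
  have h1 : ENNReal.ofReal (∫ z, (Real.log R - truncPotential ω δ z) ∂ω) ≤ kernelEnergy R ω ω := by
    rw [ofReal_integral_eq_lintegral_ofReal hint']
    · refine lintegral_mono_ae ?_
      filter_upwards [hKae] with z hz
      rw [hpot, ofReal_integral_eq_lintegral_ofReal (hintw z)]
      · refine lintegral_mono fun w => ?_
        by_cases hzw : z = w
        · rw [hzw, logKernel_self]; exact le_top
        · rw [logKernel_of_ne hzw]
          refine ENNReal.ofReal_le_ofReal (sub_le_sub_left (Real.log_le_log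
            (norm_pos_iff.2 (sub_ne_zero.2 hzw)) (le_max_left _ _)) _)
      · filter_upwards [hKae] with w hw using hnn z hz w hw
    · filter_upwards [hKae] with z hz
      rw [hpot]
      exact integral_nonneg_of_ae (by filter_upwards [hKae] with w hw using hnn z hz w hw)
  have h2 := ENNReal.ofReal_le_iff_le_toReal hE |>.1 h1
  rw [integral_sub (integrable_const _) hint] at h2
  simp at h2
  linarith

/-- If the continuous truncated potential fell below `I` at a support point, it would stay below `I
- s` on an open set `B` of positive mass. With the upper bound `I + ω(B) s / 2` elsewhere, the
integral would fall below `I`. -/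
lemma le_truncPotential_of_mem_support (hK : IsCompact K) [IsProbabilityMeasure ω] (hωK : ω Kᶜ = 0)
    (hKR : ∀ z ∈ K, ∀ w ∈ K, ‖z - w‖ ≤ R) (hE : kernelEnergy R ω ω ≠ ⊤)
    (hub : ∀ η > 0, ∃ δ₀ > 0, ∀ δ, 0 < δ → δ ≤ δ₀ →
      ∀ z ∈ K, truncPotential ω δ z ≤ Real.log R - (kernelEnergy R ω ω).toReal + η)
    {δ : ℝ} (hδ : 0 < δ) (hδR : δ ≤ R) {ζ : ℂ} (hζ : ζ ∈ ω.support) :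
    Real.log R - (kernelEnergy R ω ω).toReal ≤ truncPotential ω δ ζ := by
  set I := Real.log R - (kernelEnergy R ω ω).toReal with hI
  by_contra! hlt
  set s := (I - truncPotential ω δ ζ) / 2 with hs
  have hs0 : 0 < s := by rw [hs]; linarith
  set B := {z | truncPotential ω δ z < I - s} with hB
  have hBo : IsOpen B := (continuous_truncPotential hK hωK hδ).isOpen_preimage _ isOpen_Iio
  have hBpos : 0 < ω.real B :=
    ENNReal.toReal_pos (Measure.mem_support_iff_forall ζ |>.1 hζ B
      (hBo.mem_nhds (show truncPotential ω δ ζ < I - s by rw [hs]; linarith))).ne' (measure_ne_top _ _)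
  obtain ⟨δ₀, hδ₀, h⟩ := hub (ω.real B * s / 2) (by positivity)
  -- The potential decreases with the truncation distance, so at `δ'` both the upper bound from
  -- `hub` and the deficit on `B` hold.
  set δ' := min δ δ₀ with hδ'
  have hδ'0 : 0 < δ' := lt_min hδ hδ₀
  have h1 := le_integral_truncPotential hK hωK hKR hE hδ'0 ((min_le_left _ _).trans hδR)
  have hKae : ∀ᵐ z ∂ω, z ∈ K := mem_ae_iff.2 hωK
  have h2 : ∫ z, truncPotential ω δ' z ∂ω ≤
      ∫ z, ((I + ω.real B * s / 2) - B.indicator (fun _ => s) z) ∂ω := by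
    refine integral_mono_ae (integrable_of_continuousOn hK hωK
      (continuous_truncPotential hK hωK hδ'0).continuousOn)
      ((integrable_const _).sub ((integrable_const _).indicator hBo.measurableSet)) ?_
    filter_upwards [hKae] with z hz
    by_cases hzB : z ∈ B
    · rw [Set.indicator_of_mem hzB]
      have h3 := truncPotential_mono hK hωK hδ'0 (min_le_left δ δ₀) z
      have h4 : truncPotential ω δ z < I - s := hzB
      have : 0 ≤ ω.real B * s / 2 := by positivity
      linarith
    · rw [Set.indicator_of_notMem hzB, sub_zero]
      exact h δ' hδ'0 (min_le_right _ _) z hz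
  rw [integral_sub (integrable_const _) ((integrable_const _).indicator hBo.measurableSet),
    integral_indicator hBo.measurableSet] at h2
  simp at h2
  nlinarith

/-- At `z` the truncation at the distance `d` to the support has no effect, and the bound is carried
over from the nearest support point `ζ`. The loss at `w` is at most `d / ‖z - w‖`: at most `1` on
the disc of radius `A * d` about `ζ`, whose mass is at most `η / 2`, and at most `η / 2` elsewhere,
where `‖z - w‖ > (A - 1) * d = 2 * d / η`. -/
lemma exists_le_truncPotential_infDist (hK : IsCompact K) [IsProbabilityMeasure ω] (hωK : ω Kᶜ = 0)
    (hR : 0 < R) (hE : kernelEnergy R ω ω ≠ ⊤) {I : ℝ}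
    (hlb : ∀ δ, 0 < δ → δ ≤ R → ∀ ζ ∈ ω.support, I ≤ truncPotential ω δ ζ) {η : ℝ} (hη : 0 < η) :
    ∃ d₀ > 0, ∀ z, 0 < Metric.infDist z ω.support → Metric.infDist z ω.support ≤ d₀ →
      I - η ≤ truncPotential ω (Metric.infDist z ω.support) z := by
  obtain ⟨ρ, hρ, hball⟩ := exists_measureReal_closedBall_le hR hE (half_pos hη)
  set A := 1 + 2 / η with hA
  have hA0 : 0 < A := by positivity
  refine ⟨min R (ρ / A), by positivity, fun z hd0 hd => ?_⟩
  set d := Metric.infDist z ω.support with hddef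
  obtain ⟨ζ, hζ, hζd⟩ := Measure.isClosed_support.exists_infDist_eq_dist
    (Measure.nonempty_support (IsProbabilityMeasure.ne_zero ω)) z
  rw [← hddef, dist_eq_norm] at hζd
  have h1 := hlb d hd0 (hd.trans (min_le_left _ _)) ζ hζ
  set B := Metric.closedBall ζ (A * d) with hB
  have hBm : MeasurableSet B := Metric.isClosed_closedBall.measurableSet
  have hsupp : ∀ᵐ w ∂ω, w ∈ ω.support := Measure.support_mem_ae
  have h2 : truncPotential ω d ζ - truncPotential ω d z ≤
      ∫ w, (η / 2 + B.indicator (fun _ => (1 : ℝ)) w) ∂ω := by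
    unfold truncPotential
    rw [← integral_sub (integrable_log_max hK hωK hd0 ζ) (integrable_log_max hK hωK hd0 z)]
    refine integral_mono_ae ((integrable_log_max hK hωK hd0 ζ).sub
      (integrable_log_max hK hωK hd0 z))
      ((integrable_const _).add ((integrable_const _).indicator hBm)) ?_
    filter_upwards [hsupp] with w hw
    have hzw : d ≤ ‖z - w‖ := by
      rw [← dist_eq_norm]; exact Metric.infDist_le_dist_of_mem hw
    rw [max_eq_left hzw]
    have hpos : 0 < ‖z - w‖ := hd0.trans_le hzw
    have h3 : ‖ζ - w‖ ≤ d + ‖z - w‖ := by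
      rw [hζd, norm_sub_rev z ζ]; simpa using norm_add_le (ζ - z) (z - w)
    have h4 := log_sub_log_le (a := max ‖ζ - w‖ d) (lt_of_lt_of_le hd0 (le_max_right _ _)) hpos
    have h5 : max ‖ζ - w‖ d - ‖z - w‖ ≤ d := by
      rw [sub_le_iff_le_add]; exact max_le h3 (by linarith)
    refine h4.trans ((div_le_div_of_nonneg_right h5 hpos.le).trans ?_)
    by_cases hwB : w ∈ B
    · rw [Set.indicator_of_mem hwB]
      have : d / ‖z - w‖ ≤ 1 := (div_le_one hpos).2 hzw
      linarith
    · rw [Set.indicator_of_notMem hwB, add_zero, div_le_iff₀ hpos]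
      have h6 : A * d < ‖ζ - w‖ := by
        rw [hB, Metric.mem_closedBall, not_le, dist_comm, dist_eq_norm] at hwB
        exact hwB
      have h7 : 2 / η * d < ‖z - w‖ := by rw [hA] at h6; linarith
      rw [div_mul_eq_mul_div, div_lt_iff₀ hη] at h7
      linarith
  rw [integral_add (integrable_const _) ((integrable_const _).indicator hBm),
    integral_indicator hBm] at h2
  simp at h2
  have h8 : ω.real B ≤ η / 2 := by
    refine (measureReal_mono (Metric.closedBall_subset_closedBall ?_)).trans (hball ζ)
    have := hd.trans (min_le_right _ _)
    rw [le_div_iff₀ hA0] at this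
    linarith
  linarith

/-- A measure carried by one point has all its product mass on the diagonal, where the logarithm is
`-∞`. -/
lemma not_isPolar_nontrivial (hne : K.Nonempty) (hpol : ¬ IsPolar K) : K.Nontrivial := by
  by_contra hnt
  rw [Set.not_nontrivial_iff] at hnt
  obtain ⟨a, ha⟩ := hne
  have hKa : K = {a} := hnt.eq_singleton_of_mem ha
  refine hpol fun μ hμ hμ0 hμc hμs => ?_
  have hae : ∀ᵐ z ∂μ, z = a := by
    filter_upwards [Measure.support_mem_ae (μ := μ)] with z hz
    have := hμs hz
    rwa [hKa] at this
  have hN : (∫⁻ z, ∫⁻ w, (-ENNReal.log ‖z - w‖ₑ).toENNReal ∂μ ∂μ) = ⊤ := by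
    have h1 : ∀ᵐ z ∂μ, ∫⁻ w, (-ENNReal.log ‖z - w‖ₑ).toENNReal ∂μ = ⊤ := by
      filter_upwards [hae] with z hz
      have : ∀ᵐ w ∂μ, (-ENNReal.log ‖z - w‖ₑ).toENNReal = ⊤ := by
        filter_upwards [hae] with w hw
        simp [hz, hw]
      rw [lintegral_congr_ae this, lintegral_const, ENNReal.top_mul]
      simpa using hμ0
    rw [lintegral_congr_ae h1, lintegral_const, ENNReal.top_mul]
    simpa using hμ0
  unfold logEnergy
  rw [hN, EReal.coe_ennreal_top, EReal.sub_top]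

/-- The potential of the equilibrium measure of a connected compact set, in truncated form: it is
at most the maximal energy `I` on the set and at least `I` near the support. -/
theorem IsEquilibriumMeasure.potential_bounds (hK : IsCompact K) (hc : IsConnected K)
    (hpol : ¬ IsPolar K) (hω : IsEquilibriumMeasure ω K) :
    ∃ I : ℝ, (∀ η > 0, ∃ δ₀ > 0, ∀ δ, 0 < δ → δ ≤ δ₀ → ∀ z ∈ K, truncPotential ω δ z ≤ I + η) ∧
      ∀ η > 0, ∃ d₀ > 0, ∀ z, 0 < Metric.infDist z ω.support →
        Metric.infDist z ω.support ≤ d₀ →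
          I - η ≤ truncPotential ω (Metric.infDist z ω.support) z := by
  have := hω.1
  obtain ⟨R₀, hR₀⟩ := hK.isBounded.exists_norm_le
  set R := max 1 (2 * R₀)
  have hR : 1 ≤ R := le_max_left _ _
  have hKR : ∀ z ∈ K, ∀ w ∈ K, ‖z - w‖ ≤ R := fun z hz w hw => by
    have h1 := norm_sub_le z w
    have h2 := hR₀ z hz
    have h3 := hR₀ w hw
    have h4 : 2 * R₀ ≤ R := le_max_right _ _
    linarith
  obtain ⟨hE, hub⟩ := hω.truncPotential_le hK hc.isPreconnected hR hKR
    (not_isPolar_nontrivial hc.nonempty hpol)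
  exact ⟨_, hub, fun η hη => exists_le_truncPotential_infDist hK hω.2.1 (by linarith) hE
    (fun δ h1 h2 ζ hζ => le_truncPotential_of_mem_support hK hω.2.1 hKR hE hub h1 h2 hζ) hη⟩

end equilibrium

/-! ### Averages over roots and their limits -/

section average

variable {E : Type*} [NormedAddCommGroup E] [NormedSpace ℝ E]

/-- The average of a function over the roots of a polynomial, counted with multiplicity. -/
noncomputable def rootAvg (p : ℂ[X]) (f : ℂ → E) : E :=
  (p.natDegree : ℝ)⁻¹ • (p.roots.map f).sum

lemma rootAvg_congr {p : ℂ[X]} {f g : ℂ → E} (h : ∀ w ∈ p.roots, f w = g w) :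
    rootAvg p f = rootAvg p g := by
  unfold rootAvg; rw [Multiset.map_congr rfl h]

lemma rootAvg_sub (p : ℂ[X]) (f g : ℂ → E) :
    rootAvg p (fun w => f w - g w) = rootAvg p f - rootAvg p g := by
  unfold rootAvg; rw [Multiset.sum_map_sub, smul_sub]

lemma rootAvg_add (p : ℂ[X]) (f g : ℂ → E) :
    rootAvg p (fun w => f w + g w) = rootAvg p f + rootAvg p g := by
  unfold rootAvg; rw [Multiset.sum_map_add, smul_add]

lemma card_roots_eq_natDegree (p : ℂ[X]) : Multiset.card p.roots = p.natDegree :=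
  (IsAlgClosed.splits p).natDegree_eq_card_roots.symm

lemma rootAvg_const {p : ℂ[X]} (hp : 0 < p.natDegree) (c : E) : rootAvg p (fun _ => c) = c := by
  have : (p.natDegree : ℝ) ≠ 0 := by positivity
  unfold rootAvg
  rw [Multiset.map_const', Multiset.sum_replicate, card_roots_eq_natDegree, ← Nat.cast_smul_eq_nsmul ℝ,
    smul_smul, inv_mul_cancel₀ this, one_smul]

lemma norm_rootAvg_le_rootAvg (p : ℂ[X]) {f : ℂ → E} {g : ℂ → ℝ}
    (h : ∀ w ∈ p.roots, ‖f w‖ ≤ g w) : ‖rootAvg p f‖ ≤ rootAvg p g := by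
  unfold rootAvg
  rw [norm_smul, smul_eq_mul, Real.norm_of_nonneg (by positivity)]
  refine mul_le_mul_of_nonneg_left ?_ (by positivity)
  refine (norm_multiset_sum_le _).trans ?_
  rw [Multiset.map_map]
  exact Multiset.sum_map_le_sum_map _ _ h

lemma norm_rootAvg_le {p : ℂ[X]} (hp : 0 < p.natDegree) {f : ℂ → E} {C : ℝ}
    (h : ∀ w ∈ p.roots, ‖f w‖ ≤ C) : ‖rootAvg p f‖ ≤ C :=
  (norm_rootAvg_le_rootAvg p h).trans_eq (rootAvg_const hp C)

lemma rootAvg_const_mul (p : ℂ[X]) (c : ℝ) (f : ℂ → ℝ) :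
    rootAvg p (fun w => c * f w) = c * rootAvg p f := by
  unfold rootAvg
  rw [Multiset.sum_map_mul_left, smul_eq_mul, smul_eq_mul]; ring

lemma rootAvg_complex (p : ℂ[X]) (f : ℂ → ℂ) :
    rootAvg p f = ((rootAvg p fun w => (f w).re : ℝ) : ℂ) +
      ((rootAvg p fun w => (f w).im : ℝ) : ℂ) * Complex.I := by
  unfold rootAvg
  have hre : (p.roots.map f).sum.re = (p.roots.map fun w => (f w).re).sum := by
    have := map_multiset_sum Complex.reAddGroupHom (p.roots.map f)
    rw [Multiset.map_map] at this
    simpa using this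
  have him : (p.roots.map f).sum.im = (p.roots.map fun w => (f w).im).sum := by
    have := map_multiset_sum Complex.imAddGroupHom (p.roots.map f)
    rw [Multiset.map_map] at this
    simpa using this
  apply Complex.ext <;> simp [hre, him]

lemma integral_rootDistribution (p : ℂ[X]) (f : ℂ → ℝ) :
    ∫ z, f z ∂(rootDistribution p) = rootAvg p f := by
  have key : ∀ s : Multiset ℂ, Integrable f ((s.map fun z => Measure.dirac z).sum) ∧
      ∫ z, f z ∂((s.map fun z => Measure.dirac z).sum) = (s.map f).sum := by
    intro s
    induction s using Multiset.induction with
    | empty => simp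
    | cons a s ih =>
      have ha : Integrable f (Measure.dirac a) := integrable_dirac (by simp)
      simp only [Multiset.map_cons, Multiset.sum_cons]
      exact ⟨ha.add_measure ih.1, by rw [integral_add_measure ha ih.1, ih.2, integral_dirac]⟩
  unfold rootDistribution rootCountingMeasure rootAvg
  rw [integral_smul_measure, (key _).2]
  simp

end average

/-- Convergence of the averages over the roots of every bounded continuous function. -/
def RootAvgTendsto (q : ℕ → ℂ[X]) (ω : Measure ℂ) : Prop :=
  ∀ g : ℂ → ℝ, Continuous g → (∃ M, ∀ z, |g z| ≤ M) →
    Tendsto (fun k => rootAvg (q k) g) atTop (𝓝 (∫ z, g z ∂ω))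

lemma mem_cthickening_iff_infDist_le {S : Set ℂ} (hS : S.Nonempty) {δ : ℝ} (hδ : 0 ≤ δ) {z : ℂ} :
    z ∈ Metric.cthickening δ S ↔ Metric.infDist z S ≤ δ := by
  rw [Metric.mem_cthickening_iff, Metric.infDist,
    ENNReal.le_ofReal_iff_toReal_le (Metric.infEDist_ne_top hS) hδ]

variable {K : Set ℂ} {ω : Measure ℂ} [IsProbabilityMeasure ω] {q : ℕ → ℂ[X]}

/-- No mass escapes to infinity: the cut-off `ψ` equals `1` on `K`, so its averages tend to `1` and
the roots weighted by `1 - ψ` become negligible. This extends the convergence to bounded test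
functions. -/
lemma WeakStarTendsto.rootAvgTendsto (hK : IsCompact K) (hωK : ω Kᶜ = 0)
    (hdeg : ∀ k, 0 < (q k).natDegree)
    (h : WeakStarTendsto (fun k => rootDistribution (q k)) ω) : RootAvgTendsto q ω := by
  rintro g hg ⟨M, hM⟩
  have hKne : K.Nonempty := by
    rw [Set.nonempty_iff_ne_empty]; rintro rfl
    simp at hωK
  have hKae : ∀ᵐ z ∂ω, z ∈ K := mem_ae_iff.2 hωK
  set ψ : ℂ → ℝ := fun z => max 0 (1 - Metric.infDist z K) with hψ
  have hψc : Continuous ψ := by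
    have := Metric.continuous_infDist_pt K
    fun_prop
  have hψs : HasCompactSupport ψ := by
    refine HasCompactSupport.intro (hK.cthickening (r := 1)) fun z hz => ?_
    have : 1 < Metric.infDist z K := by
      by_contra! hle
      exact hz ((mem_cthickening_iff_infDist_le hKne zero_le_one).2 hle)
    rw [hψ]; simp only; rw [max_eq_left]; linarith
  have hψK : ∀ z ∈ K, ψ z = 1 := fun z hz => by simp [hψ, Metric.infDist_zero_of_mem hz]
  have h1 : Tendsto (fun k => rootAvg (q k) ψ) atTop (𝓝 1) := by
    have := h ψ hψc hψs
    simp only [integral_rootDistribution] at this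
    convert this using 2
    rw [integral_congr_ae (g := fun _ => (1 : ℝ)) (by filter_upwards [hKae] with z hz using hψK z hz)]
    simp
  have h2 : Tendsto (fun k => rootAvg (q k) fun z => ψ z * g z) atTop (𝓝 (∫ z, g z ∂ω)) := by
    have := h (fun z => ψ z * g z) (hψc.mul hg) hψs.mul_right
    simp only [integral_rootDistribution] at this
    have e : ∫ z, ψ z * g z ∂ω = ∫ z, g z ∂ω :=
      integral_congr_ae (by filter_upwards [hKae] with z hz using by simp [hψK z hz])
    rwa [e] at this
  have h3 : Tendsto (fun k => rootAvg (q k) fun z => (1 - ψ z) * g z) atTop (𝓝 0) := by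
    refine squeeze_zero_norm (a := fun k => M * (1 - rootAvg (q k) ψ)) (fun k => ?_) ?_
    · calc _ ≤ rootAvg (q k) (fun z => M * (1 - ψ z)) := by
            refine norm_rootAvg_le_rootAvg _ fun z _ => ?_
            have : 0 ≤ 1 - ψ z := sub_nonneg.2
              (max_le zero_le_one (by have := @Metric.infDist_nonneg _ _ K z; linarith))
            rw [norm_mul, Real.norm_of_nonneg this, mul_comm]
            exact mul_le_mul_of_nonneg_right (hM z) this
        _ = _ := by rw [rootAvg_const_mul, rootAvg_sub, rootAvg_const (hdeg k)]
    · simpa using (h1.const_sub 1).const_mul M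
  have h4 := h2.add h3
  rw [add_zero] at h4
  refine h4.congr fun k => ?_
  rw [← rootAvg_add]
  exact rootAvg_congr fun w _ => by ring

lemma RootAvgTendsto.complex (h : RootAvgTendsto q ω) {g : ℂ → ℂ} (hg : Continuous g)
    {M : ℝ} (hM : ∀ z, ‖g z‖ ≤ M) :
    Tendsto (fun k => rootAvg (q k) g) atTop (𝓝 (∫ z, g z ∂ω)) := by
  have hint : Integrable g ω := Integrable.of_bound hg.aestronglyMeasurable M (ae_of_all _ hM)
  have h1 := h (fun z => (g z).re) (Complex.continuous_re.comp hg)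
    ⟨M, fun z => (Complex.abs_re_le_norm _).trans (hM z)⟩
  have h2 := h (fun z => (g z).im) (Complex.continuous_im.comp hg)
    ⟨M, fun z => (Complex.abs_im_le_norm _).trans (hM z)⟩
  have h3 := ((Complex.continuous_ofReal.tendsto _).comp h1).add
    (((Complex.continuous_ofReal.tendsto _).comp h2).mul_const Complex.I)
  have e : (∫ z, g z ∂ω) = ((∫ z, (g z).re ∂ω : ℝ) : ℂ) + ((∫ z, (g z).im ∂ω : ℝ) : ℂ) * Complex.I :=
    (integral_re_add_im hint).symm
  rw [e]
  exact h3.congr fun k => (rootAvg_complex _ _).symm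

/-! ### Logarithmic derivatives and the Cauchy transform -/

/-- Pointwise convergence of equi-Lipschitz functions on a compact set is uniform. -/
lemma tendstoUniformlyOn_of_lipschitz {ι E : Type*} [PseudoMetricSpace E] {l : Filter ι}
    {Z : Set ℂ} (hZ : IsCompact Z) {F : ι → ℂ → E} {f : ℂ → E} {L : ℝ}
    (hF : ∀ᶠ k in l, ∀ x ∈ Z, ∀ y ∈ Z, dist (F k x) (F k y) ≤ L * dist x y)
    (hf : ∀ x ∈ Z, ∀ y ∈ Z, dist (f x) (f y) ≤ L * dist x y)
    (h : ∀ x ∈ Z, Tendsto (fun k => F k x) l (𝓝 (f x))) : TendstoUniformlyOn F f l Z := by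
  rw [Metric.tendstoUniformlyOn_iff]
  intro ε hε
  set r := ε / (3 * (|L| + 1)) with hr
  have hr0 : 0 < r := by positivity
  obtain ⟨t, htZ, htf, htc⟩ := hZ.finite_cover_balls hr0
  have hev : ∀ᶠ k in l, ∀ x ∈ t, dist (F k x) (f x) < ε / 3 :=
    htf.eventually_all.2 fun x hx => Metric.tendsto_nhds.1 (h x (htZ hx)) _ (by positivity)
  filter_upwards [hF, hev] with k hk1 hk2 x hx
  obtain ⟨y, hy, hxy⟩ := Set.mem_iUnion₂.1 (htc hx)
  rw [Metric.mem_ball] at hxy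
  have hLr : L * dist x y ≤ ε / 3 := by
    calc L * dist x y ≤ (|L| + 1) * r :=
          mul_le_mul (by linarith [le_abs_self L]) hxy.le dist_nonneg (by positivity)
      _ = ε / 3 := by rw [hr]; field_simp
  have h1 := hf x hx y (htZ hy)
  have h2 := hk1 x hx y (htZ hy)
  have h3 := hk2 y hy
  have h4 := dist_triangle4 (f x) (f y) (F k y) (F k x)
  rw [dist_comm (f y), dist_comm (F k y) (F k x)] at h4
  linarith

/-- The Cauchy transform of a measure. -/
noncomputable def cauchyTransform (ω : Measure ℂ) (z : ℂ) : ℂ := ∫ w, (z - w)⁻¹ ∂ω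

lemma derivative_div_eq_rootAvg {p : ℂ[X]} {z : ℂ} (hz : p.eval z ≠ 0) :
    p.derivative.eval z / (p.natDegree * p.eval z) = rootAvg p (fun w => (z - w)⁻¹) := by
  have := (IsAlgClosed.splits p).eval_derivative_div_eval_of_ne_zero hz
  unfold rootAvg
  simp only [one_div] at this
  rw [← this, Complex.real_smul, div_mul_eq_div_div_swap, div_eq_inv_mul]
  push_cast
  rfl

lemma norm_inv_sub_inv_le {δ : ℝ} (hδ : 0 < δ) {z z' w : ℂ} (h : δ ≤ ‖z - w‖) (h' : δ ≤ ‖z' - w‖) :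
    ‖(z - w)⁻¹ - (z' - w)⁻¹‖ ≤ 1 / δ ^ 2 * ‖z - z'‖ := by
  have h1 : z - w ≠ 0 := norm_pos_iff.1 (hδ.trans_le h)
  have h2 : z' - w ≠ 0 := norm_pos_iff.1 (hδ.trans_le h')
  rw [inv_sub_inv h1 h2, sub_sub_sub_cancel_right, norm_div, norm_mul, norm_sub_rev, div_eq_inv_mul,
    ← one_div]
  refine mul_le_mul_of_nonneg_right ?_ (norm_nonneg _)
  exact one_div_le_one_div_of_le (by positivity)
    (by rw [sq]; exact mul_le_mul h h' hδ.le (norm_nonneg _))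

/-- A bounded continuous kernel that agrees with `u⁻¹` for `δ ≤ ‖u‖`. -/
lemma exists_bounded_continuous_eq_inv {δ : ℝ} (hδ : 0 < δ) : ∃ κ : ℂ → ℂ, Continuous κ ∧
    (∀ u, ‖κ u‖ ≤ 1 / δ) ∧ ∀ u, δ ≤ ‖u‖ → κ u = u⁻¹ := by
  have hpos : ∀ u : ℂ, 0 < max ‖u‖ δ := fun u => lt_of_lt_of_le hδ (le_max_right _ _)
  refine ⟨fun u => (starRingEnd ℂ) u / (((max ‖u‖ δ) ^ 2 : ℝ) : ℂ), ?_, fun u => ?_, fun u hu => ?_⟩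
  · refine Continuous.div (by fun_prop) (by fun_prop) fun u => ?_
    exact_mod_cast (pow_pos (hpos u) 2).ne'
  · rw [norm_div, Complex.norm_real, Real.norm_of_nonneg (by positivity), Complex.norm_conj,
      div_le_div_iff₀ (by have := hpos u; positivity) hδ, one_mul, sq]
    exact mul_le_mul (le_max_left _ _) (le_max_right _ _) hδ.le (hpos u).le
  · have hu0 : u ≠ 0 := norm_pos_iff.1 (hδ.trans_le hu)
    simp only
    rw [max_eq_left hu, Complex.inv_def, Complex.normSq_eq_norm_sq, div_eq_mul_inv]
    push_cast
    rfl

/-- On a disc well inside a root-free region the kernel `(z - w)⁻¹` may be replaced by a bounded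
continuous one, so weak convergence applies pointwise, and the equi-Lipschitz bound makes it
uniform. The filter `l` is general so that ultrafilters can be used later. -/
lemma RootAvgTendsto.tendstoLocallyUniformlyOn_cauchyTransform (h : RootAvgTendsto q ω)
    (hdeg : ∀ k, 0 < (q k).natDegree) (hωK : ω Kᶜ = 0) {l : Filter ℕ} (hl : l ≤ atTop) {O : Set ℂ}
    (hO : IsOpen O) (hKO : Disjoint O K) (hfree : ∀ᶠ k in l, ∀ z ∈ O, (q k).eval z ≠ 0) :
    TendstoLocallyUniformlyOn
      (fun k z => (q k).derivative.eval z / ((q k).natDegree * (q k).eval z))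
      (cauchyTransform ω) l O := by
  intro u hu x hx
  obtain ⟨ε, hε, hεO⟩ := Metric.isOpen_iff.1 hO x hx
  set δ := ε / 2 with hδdef
  have hδ : 0 < δ := by positivity
  have hKae : ∀ᵐ z ∂ω, z ∈ K := mem_ae_iff.2 hωK
  have hfar : ∀ z ∈ Metric.closedBall x δ, ∀ w, w ∉ O → δ ≤ ‖z - w‖ := by
    intro z hz w hw
    have h1 : ε ≤ dist w x := by
      by_contra! hlt
      exact hw (hεO hlt)
    have h2 := dist_triangle w z x
    rw [Metric.mem_closedBall] at hz
    rw [← dist_eq_norm, dist_comm]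
    linarith
  have hroots : ∀ᶠ k in l, ∀ w ∈ (q k).roots, w ∉ O := by
    filter_upwards [hfree] with k hk w hw hwO
    exact hk w hwO ((mem_roots').1 hw).2
  have hKO' : ∀ w ∈ K, w ∉ O := fun w hw hwO => Set.disjoint_left.1 hKO hwO hw
  have hsub : Metric.closedBall x δ ⊆ O := fun z hz => hεO (by
    rw [Metric.mem_closedBall] at hz; rw [Metric.mem_ball]; linarith)
  obtain ⟨κ, hκc, hκb, hκ⟩ := exists_bounded_continuous_eq_inv hδ
  have hint : ∀ z ∈ Metric.closedBall x δ,
      (fun w => κ (z - w)) =ᵐ[ω] fun w => (z - w)⁻¹ := fun z hz => by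
    filter_upwards [hKae] with w hw using hκ _ (hfar z hz w (hKO' w hw))
  have hintg : ∀ z ∈ Metric.closedBall x δ, Integrable (fun w => (z - w)⁻¹) ω := fun z hz =>
    (Integrable.of_bound (hκc.comp (by fun_prop)).aestronglyMeasurable (1 / δ)
      (ae_of_all _ fun w => hκb (z - w))).congr (hint z hz)
  have key : TendstoUniformlyOn
      (fun k z => (q k).derivative.eval z / ((q k).natDegree * (q k).eval z))
      (cauchyTransform ω) l (Metric.closedBall x δ) := by
    refine tendstoUniformlyOn_of_lipschitz (L := 1 / δ ^ 2) (isCompact_closedBall x δ) ?_ ?_ ?_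
    · filter_upwards [hroots, hfree] with k hk hk' y hy z hz
      rw [derivative_div_eq_rootAvg (hk' y (hsub hy)), derivative_div_eq_rootAvg (hk' z (hsub hz)),
        dist_eq_norm, dist_eq_norm, ← rootAvg_sub]
      exact norm_rootAvg_le (hdeg k) fun w hw =>
        norm_inv_sub_inv_le hδ (hfar y hy w (hk w hw)) (hfar z hz w (hk w hw))
    · intro y hy z hz
      rw [dist_eq_norm, dist_eq_norm, cauchyTransform, cauchyTransform,
        ← integral_sub (hintg y hy) (hintg z hz)]
      refine (norm_integral_le_of_norm_le_const (C := 1 / δ ^ 2 * ‖y - z‖) ?_).trans_eq (by simp)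
      filter_upwards [hKae] with w hw
      exact norm_inv_sub_inv_le hδ (hfar y hy w (hKO' w hw)) (hfar z hz w (hKO' w hw))
    · intro z hz
      have h1 := (h.complex (hκc.comp (by fun_prop : Continuous fun w => z - w))
        (fun w => hκb (z - w))).mono_left hl
      have h2 : ∫ w, (κ ∘ fun w => z - w) w ∂ω = cauchyTransform ω z :=
        integral_congr_ae (hint z hz)
      rw [h2] at h1
      refine h1.congr' ?_
      filter_upwards [hroots, hfree] with k hk hk'
      rw [derivative_div_eq_rootAvg (hk' z (hsub hz))]
      exact rootAvg_congr fun w hw => hκ _ (hfar z hz w (hk w hw))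
  exact ⟨_, mem_nhdsWithin_of_mem_nhds (Metric.closedBall_mem_nhds x hδ), key u hu⟩

/-! ### Moving the roots into the support -/

section moved

/-- There are monic polynomials of the same degrees with roots in the support of the limit measure
and the same limit distribution. -/
lemma RootAvgTendsto.exists_roots_mem_support (h : RootAvgTendsto q ω) (hK : IsCompact K)
    (hsK : ω.support ⊆ K) :
    ∃ p : ℕ → ℂ[X], (∀ k, (p k).Monic) ∧ (∀ k, (p k).natDegree = (q k).natDegree) ∧
      (∀ k, ∀ w ∈ (p k).roots, w ∈ ω.support) ∧
      ∀ g : ℂ → ℝ, Continuous g →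
        Tendsto (fun k => rootAvg (p k) g) atTop (𝓝 (∫ z, g z ∂ω)) := by
  have hSne : ω.support.Nonempty := Measure.nonempty_support (IsProbabilityMeasure.ne_zero ω)
  have hSc : IsCompact ω.support := hK.of_isClosed_subset Measure.isClosed_support hsK
  -- The nearest-point map `π` need not be continuous; it suffices that it moves points near the
  -- support only a little.
  choose π hπ hπd using Measure.isClosed_support.exists_infDist_eq_dist hSne
  set p : ℕ → ℂ[X] := fun k => (((q k).roots.map π).map fun a => X - C a).prod with hp
  have hroots : ∀ k, (p k).roots = (q k).roots.map π := fun k => roots_multiset_prod_X_sub_C _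
  have hdeg : ∀ k, (p k).natDegree = (q k).natDegree := fun k => by
    rw [hp]; simp only
    rw [natDegree_multiset_prod_X_sub_C_eq_card, Multiset.card_map, card_roots_eq_natDegree]
  have hmem : ∀ k, ∀ w ∈ (p k).roots, w ∈ ω.support := fun k w hw => by
    rw [hroots, Multiset.mem_map] at hw
    obtain ⟨z, -, rfl⟩ := hw
    exact hπ z
  have havg : ∀ k (g : ℂ → ℝ), rootAvg (p k) g = rootAvg (q k) (g ∘ π) := fun k g => by
    unfold rootAvg; rw [hroots, hdeg, Multiset.map_map]
  have hae : ∀ᵐ z ∂ω, z ∈ ω.support := Measure.support_mem_ae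
  have hbdd : ∀ g : ℂ → ℝ, Continuous g → ∀ M, (∀ z, |g z| ≤ M) →
        Tendsto (fun k => rootAvg (p k) g) atTop (𝓝 (∫ z, g z ∂ω)) := by
    intro g hg M hM
    have hM0 : 0 ≤ M := (abs_nonneg _).trans (hM 0)
    have h1 := h g hg ⟨M, hM⟩
    suffices h2 : Tendsto (fun k => rootAvg (q k) fun z => g (π z) - g z) atTop (𝓝 0) by
      have h3 := h1.add h2
      rw [add_zero] at h3
      refine h3.congr fun k => ?_
      rw [havg, ← rootAvg_add]
      exact rootAvg_congr fun w _ => by simp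
    rw [Metric.tendsto_nhds]
    intro ε hε
    have hu := hSc.uniformContinuousAt_of_continuousAt g (fun a _ => hg.continuousAt)
      (Metric.dist_mem_uniformity (half_pos hε))
    obtain ⟨δ, hδ, hδu⟩ := Metric.mem_uniformity_dist.1 hu
    -- `χ` is `1` at distance at least `δ` from the support and integrates to `0` against `ω`, so
    -- its averages bound the vanishing proportion of roots moved far.
    set χ : ℂ → ℝ := fun z => min 1 (Metric.infDist z ω.support / δ) with hχ
    have hχ0 : ∀ z, 0 ≤ χ z := fun z => le_min zero_le_one (div_nonneg Metric.infDist_nonneg hδ.le)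
    have hχc : Continuous χ := by
      have := Metric.continuous_infDist_pt ω.support
      fun_prop
    have hχt : Tendsto (fun k => rootAvg (q k) χ) atTop (𝓝 0) := by
      have := h χ hχc ⟨1, fun z => by rw [abs_of_nonneg (hχ0 z)]; exact min_le_left _ _⟩
      rwa [integral_eq_zero_of_ae] at this
      filter_upwards [hae] with z hz
      simp [hχ, Metric.infDist_zero_of_mem hz]
    have hsmall : ∀ᶠ k in atTop, 2 * M * rootAvg (q k) χ < ε / 2 := by
      have := hχt.const_mul (2 * M)
      rw [mul_zero] at this
      exact this.eventually (gt_mem_nhds (half_pos hε))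
    filter_upwards [hsmall] with k hk
    rw [dist_zero_right]
    by_cases hd0 : (q k).natDegree = 0
    · simp [rootAvg, hd0, hε]
    have hle : ‖rootAvg (q k) fun z => g (π z) - g z‖ ≤
        rootAvg (q k) fun z => ε / 2 + 2 * M * χ z := by
      refine norm_rootAvg_le_rootAvg _ fun z _ => ?_
      rcases lt_or_ge (Metric.infDist z ω.support) δ with hlt | hge
      · rw [hπd, dist_comm] at hlt
        have h3 : dist (g (π z)) (g z) < ε / 2 := hδu hlt (hπ z)
        rw [Real.dist_eq] at h3
        have := mul_nonneg (mul_nonneg zero_le_two hM0) (hχ0 z)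
        rw [Real.norm_eq_abs]
        linarith
      · have : χ z = 1 := min_eq_left ((one_le_div hδ).2 hge)
        rw [this, Real.norm_eq_abs]
        have := abs_sub (g (π z)) (g z)
        linarith [hM (π z), hM z]
    rw [rootAvg_add, rootAvg_const (Nat.pos_of_ne_zero hd0), rootAvg_const_mul] at hle
    linarith
  refine ⟨p, fun k => monic_multiset_prod_of_monic _ _ fun a _ => monic_X_sub_C a, hdeg, hmem,
    fun g hg => ?_⟩
  -- Clamping `g` at its bound on the support changes neither side, as the new roots and `ω` live
  -- there. So unbounded test functions are allowed as well.
  obtain ⟨M, hM⟩ := hSc.exists_bound_of_continuousOn hg.continuousOn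
  have hg' : ∀ z ∈ ω.support, max (-M) (min M (g z)) = g z := fun z hz => by
    have := abs_le.1 (hM z hz)
    rw [min_eq_right this.2, max_eq_right this.1]
  have h1 := hbdd (fun z => max (-M) (min M (g z))) (by fun_prop) |M| (fun z => by
    rw [abs_le]
    constructor
    · exact (neg_le_neg (le_abs_self M)).trans (le_max_left _ _)
    · exact max_le (neg_le_abs M) ((min_le_left _ _).trans (le_abs_self M)))
  have h2 : ∫ z, max (-M) (min M (g z)) ∂ω = ∫ z, g z ∂ω :=
    integral_congr_ae (by filter_upwards [hae] with z hz using hg' z hz)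
  rw [h2] at h1
  exact h1.congr fun k => rootAvg_congr fun w hw => hg' w (hmem k w hw)

end moved

/-! ### Holomorphic `n`-th roots and critical points -/

section nthRoot

variable {K : Set ℂ} {ε : ℝ}

lemma isOpen_lt_infDist (K : Set ℂ) (ε : ℝ) : IsOpen {z : ℂ | ε < Metric.infDist z K} :=
  (Metric.continuous_infDist_pt K).isOpen_preimage _ isOpen_Ioi

/-- Off a neighbourhood of a connected set, `(z - a) / (z - b)` has a holomorphic logarithm for all
points `a`, `b` of the set. -/
lemma exists_log_quotient (hc : IsPreconnected K) (hε : 0 < ε) {a b : ℂ} (ha : a ∈ K) (hb : b ∈ K) :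
    ∃ L : ℂ → ℂ, DifferentiableOn ℂ L {z | ε < Metric.infDist z K} ∧
      ∀ z, ε < Metric.infDist z K → z - a = (z - b) * Complex.exp (L z) := by
  -- The relation is symmetric and transitive, so connectedness reduces it to nearby points. For
  -- these the quotient lies within distance `1` of `1`, where the principal logarithm is
  -- holomorphic.
  refine hc.induction₂ (fun a b => ∃ L : ℂ → ℂ, DifferentiableOn ℂ L {z | ε < Metric.infDist z K} ∧
      ∀ z, ε < Metric.infDist z K → z - a = (z - b) * Complex.exp (L z)) ?_ ?_ ?_ ha hb
  · intro x _
    have : ∀ᶠ y in 𝓝[K] x, dist y x < ε ∧ y ∈ K :=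
      (eventually_nhdsWithin_of_eventually_nhds
        (Metric.eventually_nhds_iff.2 ⟨ε, hε, fun _ h => h⟩)).and self_mem_nhdsWithin
    filter_upwards [this] with y hy
    have hfar : ∀ z, ε < Metric.infDist z K → ε < ‖z - y‖ := fun z hz => by
      rw [← dist_eq_norm]; exact hz.trans_le (Metric.infDist_le_dist_of_mem hy.2)
    have hne : ∀ z, ε < Metric.infDist z K → z - y ≠ 0 := fun z hz =>
      norm_pos_iff.1 (hε.trans (hfar z hz))
    have hslit : ∀ z, ε < Metric.infDist z K → (z - x) / (z - y) ∈ Complex.slitPlane := by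
      intro z hz
      have e : (z - x) / (z - y) = 1 + (y - x) / (z - y) := by
        field_simp [hne z hz]; ring
      rw [e]
      refine Complex.mem_slitPlane_of_norm_lt_one ?_
      rw [norm_div, div_lt_one (hε.trans (hfar z hz)), ← dist_eq_norm]
      exact hy.1.trans (hfar z hz)
    refine ⟨fun z => Complex.log ((z - x) / (z - y)), ?_, fun z hz => ?_⟩
    · refine DifferentiableOn.clog (DifferentiableOn.div (by fun_prop) (by fun_prop) hne) hslit
    · rw [Complex.exp_log (Complex.slitPlane_ne_zero (hslit z hz)), mul_div_cancel₀ _ (hne z hz)]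
  · rintro x y z - - - ⟨L₁, hd₁, h₁⟩ ⟨L₂, hd₂, h₂⟩
    refine ⟨fun z => L₁ z + L₂ z, hd₁.add hd₂, fun w hw => ?_⟩
    rw [h₁ w hw, h₂ w hw, Complex.exp_add]; ring
  · rintro x y - - ⟨L, hd, h⟩
    refine ⟨fun z => -L z, hd.neg, fun w hw => ?_⟩
    rw [h w hw, mul_assoc, ← Complex.exp_add, add_neg_cancel, Complex.exp_zero, mul_one]

lemma eval_eq_prod_sub {p : ℂ[X]} (hp : p.Monic) (z : ℂ) :
    p.eval z = (p.roots.map fun a => z - a).prod :=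
  (IsAlgClosed.splits p).eval_eq_prod_roots_of_monic hp z

/-- A monic polynomial with all roots in a connected set has a holomorphic root of order its degree
off every neighbourhood of the set. -/
lemma exists_holomorphic_root (hc : IsConnected K) (hε : 0 < ε) {p : ℂ[X]} (hp : p.Monic)
    (hdeg : 0 < p.natDegree) (hroots : ∀ w ∈ p.roots, w ∈ K) :
    ∃ φ : ℂ → ℂ, DifferentiableOn ℂ φ {z | ε < Metric.infDist z K} ∧
      ∀ z, ε < Metric.infDist z K → φ z ^ p.natDegree = p.eval z := by
  obtain ⟨b, hb⟩ := hc.nonempty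
  have key : ∀ s : Multiset ℂ, (∀ w ∈ s, w ∈ K) → ∃ G : ℂ → ℂ,
      DifferentiableOn ℂ G {z | ε < Metric.infDist z K} ∧ ∀ z, ε < Metric.infDist z K →
        (s.map fun a => z - a).prod = (z - b) ^ (Multiset.card s) * Complex.exp (G z) := by
    intro s
    induction s using Multiset.induction with
    | empty => exact fun _ => ⟨0, differentiableOn_const 0, by simp⟩
    | cons a s ih =>
      intro hs
      obtain ⟨G, hG, h⟩ := ih fun w hw => hs w (Multiset.mem_cons_of_mem hw)
      obtain ⟨L, hL, h'⟩ := exists_log_quotient hc.isPreconnected hε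
        (hs a (Multiset.mem_cons_self a s)) hb
      refine ⟨fun z => L z + G z, hL.add hG, fun z hz => ?_⟩
      rw [Multiset.map_cons, Multiset.prod_cons, h z hz, h' z hz, Multiset.card_cons,
        Complex.exp_add]
      ring
  obtain ⟨G, hG, h⟩ := key p.roots hroots
  -- Relative to the base point `b` the polynomial is `(z - b) ^ n * exp (G z)`, so dividing the
  -- exponent by `n` gives the root.
  refine ⟨fun z => (z - b) * Complex.exp (G z / p.natDegree), ?_, fun z hz => ?_⟩
  · exact DifferentiableOn.mul (by fun_prop) (hG.div_const _).cexp
  · have hn : (p.natDegree : ℂ) ≠ 0 := by exact_mod_cast hdeg.ne'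
    rw [mul_pow, ← Complex.exp_nat_mul, mul_div_cancel₀ _ hn, eval_eq_prod_sub hp, h z hz,
      card_roots_eq_natDegree]

lemma isPreconnected_exp_lt_norm (c : ℝ) : IsPreconnected {w : ℂ | Real.exp c < ‖w‖} := by
  have h : {w : ℂ | Real.exp c < ‖w‖} = Complex.exp '' {z | c < z.re} := by
    ext w
    constructor
    · intro hw
      have hw0 : w ≠ 0 := norm_pos_iff.1 ((Real.exp_pos c).trans hw)
      refine ⟨Complex.log w, ?_, Complex.exp_log hw0⟩
      change c < (Complex.log w).re
      rw [Complex.log_re]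
      exact (Real.lt_log_iff_exp_lt (norm_pos_iff.2 hw0)).2 hw
    · rintro ⟨z, hz, rfl⟩
      change Real.exp c < ‖Complex.exp z‖
      rw [Complex.norm_exp]
      exact Real.exp_lt_exp.2 hz
  rw [h]
  exact (convex_halfSpace_re_gt c).isPreconnected.image _ Complex.continuous_exp.continuousOn

lemma isCompact_norm_eval_le {p : ℂ[X]} (hdeg : 0 < p.natDegree) (B : ℝ) :
    IsCompact {z : ℂ | ‖p.eval z‖ ≤ B} := by
  have h1 : Tendsto (fun z : ℂ => ‖p.eval z‖) (cocompact ℂ) atTop :=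
    p.tendsto_norm_atTop (natDegree_pos_iff_degree_pos.1 hdeg) tendsto_norm_cocompact_atTop
  obtain ⟨C, hC, hCs⟩ := mem_cocompact.1 (h1.eventually (eventually_gt_atTop B))
  refine hC.of_isClosed_subset (isClosed_le (by fun_prop) continuous_const) fun z hz => ?_
  by_contra hzC
  have h2 : B < ‖p.eval z‖ := hCs hzC
  exact absurd hz (not_le.2 h2)

/-- Open mapping theorem: `φ` is nowhere locally constant, since its power is a nonconstant
polynomial. -/
lemma isOpen_image_holomorphic_root {p : ℂ[X]} (hdeg : 0 < p.natDegree) {φ : ℂ → ℂ} {O V : Set ℂ}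
    (hO : IsOpen O) (hV : IsOpen V) (hVO : V ⊆ O) (hφ : DifferentiableOn ℂ φ O)
    (hpow : ∀ z ∈ O, φ z ^ p.natDegree = p.eval z) : IsOpen (φ '' V) := by
  rw [isOpen_iff_mem_nhds]
  rintro _ ⟨z, hz, rfl⟩
  have han : AnalyticAt ℂ φ z := hφ.analyticAt (hO.mem_nhds (hVO hz))
  rcases han.eventually_constant_or_nhds_le_map_nhds with hconst | hle
  · exfalso
    have h1 : ∀ᶠ w in 𝓝 z, p.eval w = p.eval z := by
      filter_upwards [hconst, hO.mem_nhds (hVO hz)] with w hw hwO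
      rw [← hpow w hwO, ← hpow z (hVO hz), hw]
    have h2 : p = C (p.eval z) := eq_of_infinite_eval_eq _ _ (by
      refine (infinite_of_mem_nhds z h1).mono fun w hw => ?_
      simpa using hw)
    rw [h2, natDegree_C] at hdeg
    exact lt_irrefl _ hdeg
  · exact hle (image_mem_map (hV.mem_nhds hz))

/-- The `n` distinct `n`-th roots of `p z₀` have distinct `φ`-preimages, all of them roots of `p - p
z₀`. That polynomial has degree `n`, so its roots, `z₀` among them, are simple. -/
lemma derivative_eval_ne_zero_of_card_preimages {p : ℂ[X]} (hdeg : 0 < p.natDegree) {z₀ : ℂ}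
    (h0 : p.eval z₀ ≠ 0) {φ : ℂ → ℂ}
    (hsurj : ∀ w, w ^ p.natDegree = p.eval z₀ → ∃ z, φ z = w ∧ p.eval z = p.eval z₀) :
    p.derivative.eval z₀ ≠ 0 := by
  intro hd
  set n := p.natDegree
  set Q := p - C (p.eval z₀) with hQ
  have hQn : Q.natDegree = n := natDegree_sub_C
  have hQ0 : Q ≠ 0 := by
    intro h; rw [h, natDegree_zero] at hQn; omega
  have hsep : (X ^ n - C (p.eval z₀)).roots.Nodup :=
    nodup_roots (separable_X_pow_sub_C _ (by exact_mod_cast hdeg.ne') h0)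
  have hX0 : (X ^ n - C (p.eval z₀)) ≠ 0 := X_pow_sub_C_ne_zero hdeg _
  have hcard : (X ^ n - C (p.eval z₀)).roots.toFinset.card = n := by
    rw [Multiset.toFinset_card_of_nodup hsep, card_roots_eq_natDegree, natDegree_X_pow_sub_C]
  have hsub : (X ^ n - C (p.eval z₀)).roots.toFinset ⊆ Q.roots.toFinset.image φ := by
    intro w hw
    rw [Multiset.mem_toFinset, mem_roots hX0, IsRoot, eval_sub, eval_pow, eval_X, eval_C,
      sub_eq_zero] at hw
    obtain ⟨z, hz, hpz⟩ := hsurj w hw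
    refine Finset.mem_image.2 ⟨z, ?_, hz⟩
    rw [Multiset.mem_toFinset, mem_roots hQ0, IsRoot, hQ, eval_sub, eval_C, hpz, sub_self]
  have hle : n ≤ Q.roots.toFinset.card := by
    rw [← hcard]; exact (Finset.card_le_card hsub).trans Finset.card_image_le
  have hnodup : Q.roots.Nodup := by
    rw [← Multiset.toFinset_card_eq_card_iff_nodup]
    refine le_antisymm (Multiset.toFinset_card_le _) ?_
    rwa [card_roots_eq_natDegree, hQn]
  have h2 : 1 < Q.rootMultiplicity z₀ := by
    rw [one_lt_rootMultiplicity_iff_isRoot hQ0]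
    constructor
    · simp [hQ]
    · simp [hQ, hd]
  have h3 := Multiset.nodup_iff_count_le_one.1 hnodup z₀
  rw [count_roots] at h3
  omega

/-- If the polynomial is small near a connected set that contains all roots, then it has no critical
points where it is larger. -/
lemma derivative_eval_ne_zero_of_exp_lt (hc : IsConnected K) (hε : 0 < ε) {p : ℂ[X]}
    (hp : p.Monic) (hdeg : 0 < p.natDegree) (hroots : ∀ w ∈ p.roots, w ∈ K) {c : ℝ}
    (hsmall : ∀ z, Metric.infDist z K ≤ ε → ‖p.eval z‖ ≤ Real.exp c ^ p.natDegree) {z₀ : ℂ}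
    (hz₀ : Real.exp c ^ p.natDegree < ‖p.eval z₀‖) : p.derivative.eval z₀ ≠ 0 := by
  set n := p.natDegree with hn
  -- The root is taken off the `ε / 2`-neighbourhood, because limits of points of `V` may lie at
  -- distance exactly `ε` from `K` and `φ` must be continuous there.
  obtain ⟨φ, hφ, hpow⟩ := exists_holomorphic_root hc (half_pos hε) hp hdeg hroots
  set O := {z : ℂ | ε / 2 < Metric.infDist z K} with hOdef
  have hO : IsOpen O := isOpen_lt_infDist K _
  set V := {z : ℂ | Real.exp c ^ n < ‖p.eval z‖} with hVdef
  have hV : IsOpen V := isOpen_lt continuous_const (by fun_prop)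
  have hVε : ∀ z ∈ V, ε < Metric.infDist z K := by
    intro z hz
    by_contra! h
    exact absurd (hsmall z h) (not_le.2 hz)
  have hVO : V ⊆ O := fun z hz => by
    have := hVε z hz
    change ε / 2 < _
    linarith
  have hnorm : ∀ z ∈ O, ‖φ z‖ ^ n = ‖p.eval z‖ := fun z hz => by rw [← norm_pow, hpow z hz]
  set E := {w : ℂ | Real.exp c < ‖w‖} with hE
  have hVE : ∀ z ∈ V, φ z ∈ E := fun z hz => by
    have h1 : Real.exp c ^ n < ‖φ z‖ ^ n := by rw [hnorm z (hVO hz)]; exact hz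
    exact lt_of_pow_lt_pow_left₀ n (norm_nonneg _) h1
  -- The image is open, and relatively closed in the connected set `E`: `p` is proper, so preimages
  -- of a convergent sequence subconverge to some `y` in the domain of `φ`, and `w ∈ E` puts `y` in
  -- `V`.
  have himg : E ⊆ φ '' V := by
    refine (isPreconnected_exp_lt_norm c).subset_of_closure_inter_subset
      (isOpen_image_holomorphic_root hdeg hO hV hVO hφ hpow)
      ⟨φ z₀, hVE z₀ hz₀, z₀, hz₀, rfl⟩ ?_
    rintro w ⟨hwc, hwE⟩
    obtain ⟨x, hx, hxw⟩ := mem_closure_iff_seq_limit.1 hwc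
    choose z hzV hzx using hx
    have hbdd : ∃ B, ∀ j, ‖x j‖ ≤ B := by
      obtain ⟨B, hB⟩ := (Metric.isBounded_range_of_tendsto x hxw).exists_norm_le
      exact ⟨B, fun j => hB _ ⟨j, rfl⟩⟩
    obtain ⟨B, hB⟩ := hbdd
    have hzB : ∀ j, z j ∈ {z : ℂ | ‖p.eval z‖ ≤ B ^ n} := fun j => by
      change ‖p.eval (z j)‖ ≤ B ^ n
      rw [← hnorm _ (hVO (hzV j)), hzx]
      exact pow_le_pow_left₀ (norm_nonneg _) (hB j) n
    obtain ⟨y, -, ψ, hψ, hy⟩ := (isCompact_norm_eval_le hdeg (B ^ n)).tendsto_subseq hzB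
    have hyO : y ∈ O := by
      have h1 : Tendsto (fun j => Metric.infDist (z (ψ j)) K) atTop (𝓝 (Metric.infDist y K)) :=
        ((Metric.continuous_infDist_pt K).tendsto y).comp hy
      have h2 : ε ≤ Metric.infDist y K :=
        ge_of_tendsto' h1 fun j => (hVε _ (hzV _)).le
      change ε / 2 < _
      linarith
    have hcont : ContinuousAt φ y := (hφ.differentiableAt (hO.mem_nhds hyO)).continuousAt
    have h1 : Tendsto (fun j => x (ψ j)) atTop (𝓝 (φ y)) := by
      refine (hcont.tendsto.comp hy).congr fun j => ?_
      simp [hzx]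
    have h2 : φ y = w := tendsto_nhds_unique h1 (hxw.comp hψ.tendsto_atTop)
    refine ⟨y, ?_, h2⟩
    change Real.exp c ^ n < ‖p.eval y‖
    rw [← hnorm y hyO, h2]
    exact pow_lt_pow_left₀ hwE (Real.exp_pos c).le hdeg.ne'
  have h0 : p.eval z₀ ≠ 0 := norm_pos_iff.1 ((pow_pos (Real.exp_pos c) n).trans hz₀)
  refine derivative_eval_ne_zero_of_card_preimages (φ := φ) hdeg h0 fun w hw => ?_
  have hwE : w ∈ E := by
    have h1 : Real.exp c ^ n < ‖w‖ ^ n := by rw [← norm_pow, hw]; exact hz₀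
    exact lt_of_pow_lt_pow_left₀ n (norm_nonneg _) h1
  obtain ⟨z, hz, hzw⟩ := himg hwE
  exact ⟨z, hzw, by rw [← hpow z (hVO hz), hzw, hw]⟩

end nthRoot

/-- A locally uniform limit of zero-free holomorphic functions that has a zero vanishes near it. -/
lemma eventually_eq_zero_of_tendstoLocallyUniformlyOn {l : Filter ℕ} [l.NeBot] {O : Set ℂ}
    (hO : IsOpen O) {F : ℕ → ℂ → ℂ} {f : ℂ → ℂ} (h : TendstoLocallyUniformlyOn F f l O)
    (hF : ∀ᶠ k in l, DifferentiableOn ℂ (F k) O) (hne : ∀ᶠ k in l, ∀ z ∈ O, F k z ≠ 0)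
    {z₀ : ℂ} (hz₀ : z₀ ∈ O) (hf0 : f z₀ = 0) : ∀ᶠ z in 𝓝 z₀, f z = 0 := by
  have hf : DifferentiableOn ℂ f O := h.differentiableOn hF hO
  rcases (hf.analyticAt (hO.mem_nhds hz₀)).eventually_eq_zero_or_eventually_ne_zero with h0 | h0
  · exact h0
  exfalso
  obtain ⟨r, hr, hrs⟩ := Metric.mem_nhds_iff.1
    (inter_mem (hO.mem_nhds hz₀) (eventually_nhdsWithin_iff.1 h0))
  set s := r / 2 with hs
  have hs0 : 0 < s := by positivity
  have hsub : Metric.closedBall z₀ s ⊆ Metric.ball z₀ r :=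
    Metric.closedBall_subset_ball (by rw [hs]; linarith)
  have hsph : Metric.sphere z₀ s ⊆ O := fun z hz =>
    (hrs (hsub (Metric.sphere_subset_closedBall hz))).1
  have hfs : ∀ z ∈ Metric.sphere z₀ s, f z ≠ 0 := fun z hz =>
    (hrs (hsub (Metric.sphere_subset_closedBall hz))).2 (Metric.ne_of_mem_sphere hz hs0.ne')
  obtain ⟨y, hy, hmin⟩ := (isCompact_sphere z₀ s).exists_isMinOn
    (NormedSpace.sphere_nonempty.2 hs0.le) (hf.continuousOn.mono hsph).norm
  set c := ‖f y‖ with hc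
  have hc0 : 0 < c := norm_pos_iff.2 (hfs y hy)
  have hunif := (tendstoLocallyUniformlyOn_iff_forall_isCompact hO).1 h _ hsph (isCompact_sphere z₀ s)
  have h1 := Metric.tendstoUniformlyOn_iff.1 hunif (c / 2) (half_pos hc0)
  have h2 : ∀ᶠ k in l, dist (F k z₀) (f z₀) < c / 2 :=
    Metric.tendsto_nhds.1 (h.tendsto_at hz₀) _ (half_pos hc0)
  obtain ⟨k, hk1, hk2, hk3, hk4⟩ := (h1.and (h2.and (hF.and hne))).exists
  have hcl : Metric.closedBall z₀ s ⊆ O := fun z hz => (hrs (hsub hz)).1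
  -- Minimum principle for `F k`, through its inverse: `|F k| > c / 2` on the circle would give `|F
  -- k z₀| ≥ c / 2`, although `F k z₀` is close to `f z₀ = 0`.
  have hdiff : DiffContOnCl ℂ (fun z => (F k z)⁻¹) (Metric.ball z₀ s) := by
    refine DifferentiableOn.diffContOnCl ?_
    rw [closure_ball z₀ hs0.ne']
    exact (hk3.mono hcl).inv fun z hz => hk4 z (hcl hz)
  have h3 := Complex.norm_le_of_forall_mem_frontier_norm_le Metric.isBounded_ball hdiff
    (C := (c / 2)⁻¹) (fun z hz => by
      rw [frontier_ball z₀ hs0.ne'] at hz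
      rw [norm_inv]
      refine inv_anti₀ (half_pos hc0) ?_
      have h4 := hk1 z hz
      have h5 : c ≤ ‖f z‖ := hmin hz
      rw [dist_eq_norm] at h4
      have h6 := norm_sub_norm_le (f z) (F k z)
      linarith) (subset_closure (Metric.mem_ball_self hs0))
  rw [norm_inv] at h3
  have h7 := (inv_le_inv₀ (norm_pos_iff.2 (hk4 z₀ hz₀)) (half_pos hc0)).1 h3
  rw [hf0, dist_zero_right] at hk2
  linarith

/-! ### Monic polynomials as exponentials of discrete potentials -/

section monic

variable {p : ℂ[X]}

lemma natDegree_mul_rootAvg (hdeg : 0 < p.natDegree) (f : ℂ → ℝ) :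
    p.natDegree * rootAvg p f = (p.roots.map f).sum := by
  have : (p.natDegree : ℝ) ≠ 0 := by positivity
  unfold rootAvg
  rw [smul_eq_mul, mul_inv_cancel_left₀ this]

lemma norm_eval_eq_prod (hp : p.Monic) (z : ℂ) :
    ‖p.eval z‖ = (p.roots.map fun w => ‖z - w‖).prod := by
  rw [eval_eq_prod_sub hp]
  have := map_multiset_prod (normHom : ℂ →*₀ ℝ) (p.roots.map fun w => z - w)
  rw [Multiset.map_map] at this
  exact this

lemma prod_max_eq_exp (hdeg : 0 < p.natDegree) {δ : ℝ} (hδ : 0 < δ) (z : ℂ) :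
    (p.roots.map fun w => max ‖z - w‖ δ).prod =
      Real.exp (p.natDegree * rootAvg p fun w => Real.log (max ‖z - w‖ δ)) := by
  rw [natDegree_mul_rootAvg hdeg, Real.exp_multiset_sum, Multiset.map_map]
  congr 1
  refine Multiset.map_congr rfl fun w _ => ?_
  simp [Real.exp_log (lt_of_lt_of_le hδ (le_max_right ‖z - w‖ δ))]

lemma norm_eval_le_exp (hp : p.Monic) (hdeg : 0 < p.natDegree) {δ : ℝ} (hδ : 0 < δ) (z : ℂ) :
    ‖p.eval z‖ ≤ Real.exp (p.natDegree * rootAvg p fun w => Real.log (max ‖z - w‖ δ)) := by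
  rw [norm_eval_eq_prod hp, ← prod_max_eq_exp hdeg hδ]
  exact Multiset.prod_map_le_prod_map₀ _ _ (fun w _ => norm_nonneg _) fun w _ => le_max_left _ _

lemma norm_eval_eq_exp (hp : p.Monic) (hdeg : 0 < p.natDegree) {δ : ℝ} (hδ : 0 < δ) {z : ℂ}
    (h : ∀ w ∈ p.roots, δ ≤ ‖z - w‖) :
    ‖p.eval z‖ = Real.exp (p.natDegree * rootAvg p fun w => Real.log (max ‖z - w‖ δ)) := by
  rw [norm_eval_eq_prod hp, ← prod_max_eq_exp hdeg hδ]
  congr 1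
  exact Multiset.map_congr rfl fun w hw => (max_eq_left (h w hw)).symm

lemma le_rootAvg (hdeg : 0 < p.natDegree) {f : ℂ → ℝ} {c : ℝ} (h : ∀ w ∈ p.roots, c ≤ f w) :
    c ≤ rootAvg p f := by
  rw [← rootAvg_const hdeg c]
  unfold rootAvg
  refine mul_le_mul_of_nonneg_left ?_ (by positivity)
  exact Multiset.sum_map_le_sum_map _ _ h

end monic

lemma exists_norm_eval_le_pow (P : ℂ[X]) :
    ∃ A, ∀ z : ℂ, 1 ≤ ‖z‖ → ‖P.eval z‖ ≤ A * ‖z‖ ^ P.natDegree := by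
  refine ⟨∑ i ∈ Finset.range (P.natDegree + 1), ‖P.coeff i‖, fun z hz => ?_⟩
  rw [eval_eq_sum_range, Finset.sum_mul]
  refine (norm_sum_le _ _).trans (Finset.sum_le_sum fun i hi => ?_)
  rw [norm_mul, norm_pow]
  exact mul_le_mul_of_nonneg_left
    (pow_le_pow_right₀ hz (Nat.lt_succ_iff.1 (Finset.mem_range.1 hi))) (norm_nonneg _)

/-- A polynomial is eventually smaller than any multiple of a power above its degree. -/
lemma exists_forall_norm_eval_le (P : ℂ[X]) {c : ℝ} (hc : 0 < c) (R₀ : ℝ) :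
    ∃ R₁, ∀ R, R₁ ≤ R → ∀ z : ℂ, ‖z‖ = R → ‖P.eval z‖ ≤ c * (R - R₀) ^ (P.natDegree + 1) := by
  obtain ⟨A, hA⟩ := exists_norm_eval_le_pow P
  set D := P.natDegree + 1 with hD
  refine ⟨max 1 (max (2 * R₀) (A * 2 ^ D / c)), fun R hR z hz => ?_⟩
  have h1 : 1 ≤ R := (le_max_left _ _).trans hR
  have h2 : 2 * R₀ ≤ R := ((le_max_left _ _).trans (le_max_right _ _)).trans hR
  have h3 : A * 2 ^ D / c ≤ R := ((le_max_right _ _).trans (le_max_right _ _)).trans hR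
  rw [div_le_iff₀ hc] at h3
  have h4 := hA z (by rw [hz]; exact h1)
  rw [hz] at h4
  have h5 : (R / 2) ^ D ≤ (R - R₀) ^ D := pow_le_pow_left₀ (by linarith) (by linarith) D
  calc ‖P.eval z‖ ≤ A * R ^ P.natDegree := h4
    _ = (A * 2 ^ D) * R ^ P.natDegree / 2 ^ D := by field_simp
    _ ≤ (R * c) * R ^ P.natDegree / 2 ^ D := by gcongr
    _ = c * (R / 2) ^ D := by rw [div_pow, hD, pow_succ R]; ring
    _ ≤ _ := mul_le_mul_of_nonneg_left h5 hc.le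

/-! ### The equilibrium potential off `K` -/

section limit

variable {K : Set ℂ} {ω : Measure ℂ} [IsProbabilityMeasure ω] {p : ℕ → ℂ[X]}

lemma tendstoUniformlyOn_rootAvg_log_max (hK : IsCompact K) (hωK : ω Kᶜ = 0)
    (hdeg : ∀ k, 0 < (p k).natDegree)
    (hlim : ∀ g : ℂ → ℝ, Continuous g →
      Tendsto (fun k => rootAvg (p k) g) atTop (𝓝 (∫ z, g z ∂ω)))
    {δ : ℝ} (hδ : 0 < δ) {Z : Set ℂ} (hZ : IsCompact Z) :
    TendstoUniformlyOn (fun k z => rootAvg (p k) fun w => Real.log (max ‖z - w‖ δ))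
      (truncPotential ω δ) atTop Z := by
  refine tendstoUniformlyOn_of_lipschitz (L := 1 / δ) hZ (Eventually.of_forall fun k x _ y _ => ?_)
    (fun x _ y _ => ?_) fun x _ => ?_
  · rw [dist_eq_norm, dist_eq_norm, ← rootAvg_sub]
    refine norm_rootAvg_le (hdeg k) fun w _ => ?_
    rw [Real.norm_eq_abs, abs_le, div_mul_eq_mul_div, one_mul]
    have h1 := log_max_sub_le hδ x y w
    have h2 := log_max_sub_le hδ y x w
    rw [norm_sub_rev y x] at h2
    constructor <;> linarith
  · rw [Real.dist_eq, dist_eq_norm, abs_le, div_mul_eq_mul_div, one_mul]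
    have h1 := truncPotential_sub_le hK hωK hδ x y
    have h2 := truncPotential_sub_le hK hωK hδ y x
    rw [norm_sub_rev] at h2
    constructor <;> linarith
  · exact hlim _ ((continuous_log_max hδ).comp (by fun_prop : Continuous fun w : ℂ => (x, w)))

lemma truncPotential_eq_of_le_infDist {ω : Measure ℂ} {δ δ' : ℝ} {z : ℂ}
    (h : δ ≤ Metric.infDist z ω.support) (h' : δ' ≤ Metric.infDist z ω.support) :
    truncPotential ω δ z = truncPotential ω δ' z := by
  refine integral_congr_ae ?_
  filter_upwards [Measure.support_mem_ae (μ := ω)] with w hw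
  have := Metric.infDist_le_dist_of_mem (x := z) hw
  rw [dist_eq_norm] at this
  rw [max_eq_left (h.trans this), max_eq_left (h'.trans this)]

lemma exists_eval_lt_one_of_notMem (hne : K.Nonempty)
    (hconv : IsPolynomiallyConvex K) {z₀ : ℂ} (hz₀ : z₀ ∉ K) :
    ∃ P : ℂ[X], (∀ w ∈ K, ‖P.eval w‖ < 1) ∧ 1 < ‖P.eval z₀‖ := by
  rw [← hconv] at hz₀
  simp only [polynomialHull, Set.mem_ofPred_eq, not_forall, not_le] at hz₀
  obtain ⟨P, M, hM, hlt⟩ := hz₀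
  obtain ⟨M', h1, h2⟩ := exists_between hlt
  have hM0 : 0 < M' := by
    obtain ⟨w, hw⟩ := hne
    exact ((norm_nonneg _).trans (hM w hw)).trans_lt h1
  have hn : ‖((M' : ℂ))⁻¹‖ = M'⁻¹ := by rw [norm_inv, Complex.norm_real, Real.norm_of_nonneg hM0.le]
  refine ⟨C ((M' : ℂ))⁻¹ * P, fun w hw => ?_, ?_⟩
  · rw [eval_mul, eval_C, norm_mul, hn, inv_mul_lt_one₀ hM0]
    exact (hM w hw).trans_lt h1
  · rw [eval_mul, eval_C, norm_mul, hn, ← div_eq_inv_mul, one_lt_div hM0]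
    exact h2

/-- Comparison of a polynomial with a monic polynomial by the maximum principle on the exterior of
the roots. -/
lemma norm_eval_pow_le_of_frontier {P p : ℂ[X]} {S : Set ℂ} {d R b : ℝ} {D : ℕ} (hd : 0 < d)
    (hp : p.Monic) (hdeg : 0 < p.natDegree) (hS : ∀ w ∈ p.roots, w ∈ S)
    (hin : ∀ z, Metric.infDist z S = d →
      ‖P.eval z‖ ≤ Real.exp (D * ((rootAvg p fun w => Real.log (max ‖z - w‖ d)) - b)))
    (hout : ∀ z, ‖z‖ = R → d ≤ Metric.infDist z S →
      ‖P.eval z‖ ≤ Real.exp (D * ((rootAvg p fun w => Real.log (max ‖z - w‖ d)) - b)))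
    {z₀ : ℂ} (hz₀ : d < Metric.infDist z₀ S) (hz₀R : ‖z₀‖ < R) :
    ‖P.eval z₀‖ ≤ Real.exp (D * ((rootAvg p fun w => Real.log (max ‖z₀ - w‖ d)) - b)) := by
  set n := p.natDegree with hn
  set u : ℂ → ℝ := fun z => rootAvg p fun w => Real.log (max ‖z - w‖ d) with hu
  have hnorm : ∀ z, d ≤ Metric.infDist z S → ‖p.eval z‖ = Real.exp (n * u z) := fun z hz =>
    norm_eval_eq_exp hp hdeg hd fun w hw => by
      rw [← dist_eq_norm]; exact hz.trans (Metric.infDist_le_dist_of_mem (hS w hw))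
  have hne : ∀ z, d ≤ Metric.infDist z S → p.eval z ≠ 0 := fun z hz =>
    norm_pos_iff.1 (by rw [hnorm z hz]; exact Real.exp_pos _)
  -- Since `|p| = exp (n * u)`, the modulus of `f` is the `n`-th power of `|P| * exp (-D * u)`.
  -- Taking powers replaces the comparison of `log |P|` with `D * u` by the maximum principle for a
  -- single-valued holomorphic function.
  set f : ℂ → ℂ := fun z => P.eval z ^ n / p.eval z ^ D with hf
  have hfn : ∀ z, d ≤ Metric.infDist z S → ‖f z‖ = ‖P.eval z‖ ^ n / Real.exp (n * u z) ^ D :=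
    fun z hz => by rw [hf]; simp only; rw [norm_div, norm_pow, norm_pow, hnorm z hz]
  have hexp : ∀ z, Real.exp (D * (u z - b)) ^ n =
      Real.exp (-(n * D * b)) * Real.exp (n * u z) ^ D := fun z => by
    rw [← Real.exp_nat_mul, ← Real.exp_nat_mul, ← Real.exp_add]; congr 1; ring
  set W := {z : ℂ | d < Metric.infDist z S} ∩ Metric.ball 0 R with hW
  have hWo : IsOpen W := (isOpen_lt_infDist S d).inter Metric.isOpen_ball
  have hcl : closure W ⊆ {z | d ≤ Metric.infDist z S} ∩ Metric.closedBall 0 R :=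
    closure_minimal (Set.inter_subset_inter (fun z (hz : d < Metric.infDist z S) => hz.le) Metric.ball_subset_closedBall)
      ((isClosed_le continuous_const (Metric.continuous_infDist_pt S)).inter
        Metric.isClosed_closedBall)
  have hdiff : DiffContOnCl ℂ f W := by
    refine DifferentiableOn.diffContOnCl ?_
    refine DifferentiableOn.div (by fun_prop) (by fun_prop) fun z hz => ?_
    exact pow_ne_zero _ (hne z (hcl hz).1)
  have h1 := Complex.norm_le_of_forall_mem_frontier_norm_le
    (Metric.isBounded_ball.subset Set.inter_subset_right) hdiff
    (C := Real.exp (-(n * D * b))) (fun z hz => by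
      have hzc := hcl (frontier_subset_closure hz)
      have hzW : z ∉ W := by rw [hWo.frontier_eq] at hz; exact hz.2
      have hb : ‖P.eval z‖ ≤ Real.exp (D * (u z - b)) := by
        by_cases hzd : Metric.infDist z S = d
        · exact hin z hzd
        · refine hout z (le_antisymm (by simpa using hzc.2) ?_) hzc.1
          by_contra! hlt
          exact hzW ⟨lt_of_le_of_ne hzc.1 (Ne.symm hzd), by simpa using hlt⟩
      rw [hfn z hzc.1, div_le_iff₀ (by positivity), ← hexp]
      exact pow_le_pow_left₀ (norm_nonneg _) hb n)
    (subset_closure (show z₀ ∈ W from ⟨hz₀, by simpa using hz₀R⟩))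
  rw [hfn z₀ hz₀.le, div_le_iff₀ (by positivity), ← hexp] at h1
  exact le_of_pow_le_pow_left₀ hdeg.ne' (Real.exp_pos _).le h1

/-- The equilibrium potential exceeds its maximum on `K` at every point off `K`. -/
lemma lt_truncPotential_of_notMem (hK : IsCompact K) (hne : K.Nonempty) (hωK : ω Kᶜ = 0)
    (hsK : ω.support ⊆ K)
    (hconv : IsPolynomiallyConvex K) (hmonic : ∀ k, (p k).Monic) (hdeg : ∀ k, 0 < (p k).natDegree)
    (hroots : ∀ k, ∀ w ∈ (p k).roots, w ∈ ω.support)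
    (hlim : ∀ g : ℂ → ℝ, Continuous g →
      Tendsto (fun k => rootAvg (p k) g) atTop (𝓝 (∫ z, g z ∂ω)))
    {I : ℝ} (hlb : ∀ η > 0, ∃ d₀ > 0, ∀ z, 0 < Metric.infDist z ω.support →
        Metric.infDist z ω.support ≤ d₀ →
          I - η ≤ truncPotential ω (Metric.infDist z ω.support) z)
    {z₀ : ℂ} (hz₀ : z₀ ∉ K) {δ : ℝ} (hδ : δ ≤ Metric.infDist z₀ ω.support) :
    I < truncPotential ω δ z₀ := by
  have hSne : ω.support.Nonempty := Measure.nonempty_support (IsProbabilityMeasure.ne_zero ω)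
  have hSc : IsCompact ω.support := hK.of_isClosed_subset Measure.isClosed_support hsK
  have hpos : 0 < Metric.infDist z₀ ω.support :=
    (Measure.isClosed_support.notMem_iff_infDist_pos hSne).1 fun h => hz₀ (hsK h)
  obtain ⟨P, hP1, hP0⟩ := exists_eval_lt_one_of_notMem hne hconv hz₀
  obtain ⟨d₁, hd₁, hd₁P⟩ := hSc.exists_cthickening_subset_open
    (isOpen_lt (by fun_prop : Continuous fun z : ℂ => ‖P.eval z‖) continuous_const)
    fun w hw => hP1 w (hsK hw)
  -- One more than the degree, so that `D * u`, growing like `D * log |z|`, dominates `log |P|` on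
  -- large circles.
  set D := P.natDegree + 1 with hD
  have hD0 : (0 : ℝ) < D := by positivity
  set b := Real.log ‖P.eval z₀‖ with hb
  have hb0 : 0 < b := Real.log_pos hP0
  -- The comparison gives `b = 4 * D * η ≤ D * (u(z₀) - (I - 2 * η))` for the discrete potential
  -- `u`, so `u(z₀) ≥ I + 2 * η`; passing to `ω` costs less than `η`.
  set η := b / (4 * D) with hη
  have hη0 : 0 < η := by positivity
  obtain ⟨d₀, hd₀, hlb'⟩ := hlb η hη0
  set d := min (min d₀ d₁) (Metric.infDist z₀ ω.support / 2) with hd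
  have hdpos : 0 < d := by positivity
  have hdd0 : d ≤ d₀ := (min_le_left _ _).trans (min_le_left _ _)
  have hdd1 : d ≤ d₁ := (min_le_left _ _).trans (min_le_right _ _)
  have hdz : d < Metric.infDist z₀ ω.support := (min_le_right _ _).trans_lt (by linarith)
  rw [truncPotential_eq_of_le_infDist hδ hdz.le]
  obtain ⟨R₀, hR₀⟩ := hSc.isBounded.exists_norm_le
  obtain ⟨R₁, hR₁⟩ := exists_forall_norm_eval_le P
    (Real.exp_pos (-(D * (I - 2 * η)))) R₀
  set R := max (max R₁ (‖z₀‖ + 1)) (R₀ + 1) with hR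
  have hRz : ‖z₀‖ < R := by
    have : ‖z₀‖ + 1 ≤ R := (le_max_right _ _).trans (le_max_left _ _)
    linarith
  have hRR₁ : R₁ ≤ R := (le_max_left _ _).trans (le_max_left _ _)
  have hRR₀ : 0 < R - R₀ := by
    have : R₀ + 1 ≤ R := le_max_right _ _
    linarith
  set Z := {z : ℂ | Metric.infDist z ω.support = d} ∪ {z₀} with hZ
  have hZc : IsCompact Z := by
    refine IsCompact.union ?_ isCompact_singleton
    refine (hSc.cthickening (r := d)).of_isClosed_subset
      (isClosed_eq (Metric.continuous_infDist_pt _) continuous_const) fun z hz => ?_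
    exact (mem_cthickening_iff_infDist_le hSne hdpos.le).2 (le_of_eq hz)
  obtain ⟨k, hk⟩ := (Metric.tendstoUniformlyOn_iff.1
    (tendstoUniformlyOn_rootAvg_log_max hK hωK hdeg hlim hdpos hZc) η hη0).exists
  have h1 : ‖P.eval z₀‖ ≤ Real.exp (D * ((rootAvg (p k) fun w => Real.log (max ‖z₀ - w‖ d)) -
      (I - 2 * η))) := by
    refine norm_eval_pow_le_of_frontier hdpos (hmonic k) (hdeg k) (hroots k) (fun z hz => ?_)
      (fun z hz hzd => ?_) hdz hRz
    · have h2 := hk z (Or.inl hz)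
      have h3 := hlb' z (by rw [hz]; exact hdpos) (by rw [hz]; exact hdd0)
      rw [hz] at h3
      rw [Real.dist_eq] at h2
      have h4 := (abs_lt.1 h2).2
      have h5 : ‖P.eval z‖ < 1 := hd₁P
        ((mem_cthickening_iff_infDist_le hSne hd₁.le).2 (by rw [hz]; exact hdd1))
      refine h5.le.trans (Real.one_le_exp (mul_nonneg hD0.le ?_))
      linarith
    · refine (hR₁ R hRR₁ z hz).trans ?_
      have h2 : Real.log (R - R₀) ≤ rootAvg (p k) fun w => Real.log (max ‖z - w‖ d) := by
        refine le_rootAvg (hdeg k) fun w hw => Real.log_le_log hRR₀ ((le_max_left _ _).trans' ?_)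
        have h3 := norm_sub_norm_le z w
        have h4 := hR₀ w (hroots k w hw)
        rw [hz] at h3
        linarith
      rw [← Real.exp_log hRR₀, ← Real.exp_nat_mul, ← Real.exp_add]
      refine Real.exp_le_exp.2 ?_
      have := mul_le_mul_of_nonneg_left h2 hD0.le
      rw [mul_sub]
      linarith
  rw [← Real.log_le_iff_le_exp (by linarith)] at h1
  have h2 := hk z₀ (Or.inr rfl)
  rw [Real.dist_eq] at h2
  have h3 := (abs_lt.1 h2).1
  have h4 : D * (4 * η) = b := by rw [hη]; field_simp
  have h5 : D * (4 * η) ≤ D * ((rootAvg (p k) fun w => Real.log (max ‖z₀ - w‖ d)) -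
      (I - 2 * η)) := by rw [h4]; exact h1
  have h6 := le_of_mul_le_mul_left h5 hD0
  linarith

end limit

/-! ### The Cauchy transform has no zeros off `K` -/

section connected

variable {K : Set ℂ} {ω : Measure ℂ} [IsProbabilityMeasure ω]

/-- The frontier of a component of the complement lies in `K`, so by the maximum principle a bounded
component would lie in the polynomial hull. -/
lemma not_isBounded_connectedComponentIn_compl (hK : IsCompact K) (hconv : IsPolynomiallyConvex K)
    {z₀ : ℂ} (hz₀ : z₀ ∉ K) : ¬ Bornology.IsBounded (connectedComponentIn Kᶜ z₀) := by
  intro hb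
  set V := connectedComponentIn Kᶜ z₀ with hV
  have hVo : IsOpen V := hK.isClosed.isOpen_compl.connectedComponentIn
  have hmem : z₀ ∈ V := mem_connectedComponentIn hz₀
  have hfr : frontier V ⊆ K := by
    intro x hx
    by_contra hxK
    rw [hVo.frontier_eq] at hx
    have hxo : IsOpen (connectedComponentIn Kᶜ x) := hK.isClosed.isOpen_compl.connectedComponentIn
    obtain ⟨y, hy1, hy2⟩ := mem_closure_iff.1 hx.1 _ hxo (mem_connectedComponentIn hxK)
    apply hx.2
    rw [hV, connectedComponentIn_eq hy2, ← connectedComponentIn_eq hy1]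
    exact mem_connectedComponentIn hxK
  apply hz₀
  rw [← hconv]
  intro P M hM
  exact Complex.norm_le_of_forall_mem_frontier_norm_le (f := fun z => P.eval z) hb
    (Differentiable.diffContOnCl (by fun_prop)) (fun z hz => hM z (hfr hz)) (subset_closure hmem)

/-- If the transform vanished at `z`, then `1 - z / (z - w) = -w / (z - w)` would have integral `1`,
but its norm on `K` is at most `R₀ / (‖z‖ - R₀) < 1`. -/
lemma cauchyTransform_ne_zero_of_large (hωK : ω Kᶜ = 0) {R₀ : ℝ}
    (hR₀ : ∀ w ∈ K, ‖w‖ ≤ R₀) {z : ℂ} (hz : 2 * R₀ < ‖z‖) (hz0 : 0 < ‖z‖)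
    (hint : Integrable (fun w => (z - w)⁻¹) ω) : cauchyTransform ω z ≠ 0 := by
  intro h0
  have hKae : ∀ᵐ z ∂ω, z ∈ K := mem_ae_iff.2 hωK
  have h1 : ∫ w, (1 - z * (z - w)⁻¹) ∂ω = 1 := by
    rw [integral_sub (integrable_const _) (hint.const_mul _), integral_const_mul]
    change _ - z * cauchyTransform ω z = 1
    rw [h0]; simp
  have h2 : ‖∫ w, (1 - z * (z - w)⁻¹) ∂ω‖ ≤ R₀ / (‖z‖ - R₀) := by
    refine (norm_integral_le_of_norm_le_const (C := R₀ / (‖z‖ - R₀)) ?_).trans_eq (by simp)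
    filter_upwards [hKae] with w hw
    have h3 := hR₀ w hw
    have h4 : ‖z‖ - R₀ ≤ ‖z - w‖ := by have := norm_sub_norm_le z w; linarith
    have h5 : 0 < ‖z‖ - R₀ := by have := norm_nonneg w; linarith
    have h6 : z - w ≠ 0 := norm_pos_iff.1 (h5.trans_le h4)
    have h7 : 1 - z * (z - w)⁻¹ = -w / (z - w) := by field_simp; ring
    rw [h7, norm_div, norm_neg]
    exact div_le_div₀ ((norm_nonneg _).trans h3) h3 h5 h4
  rw [h1, norm_one] at h2
  have h8 : 0 < ‖z‖ - R₀ := by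
    by_contra! hle
    have : R₀ / (‖z‖ - R₀) ≤ 0 := div_nonpos_of_nonneg_of_nonpos (by linarith) hle
    linarith
  rw [le_div_iff₀ h8] at h2
  linarith

lemma integrable_inv_sub (hK : IsCompact K) (hωK : ω Kᶜ = 0) {z : ℂ} (hz : z ∉ K) :
    Integrable (fun w => (z - w)⁻¹) ω :=
  integrable_of_continuousOn hK hωK (ContinuousOn.inv₀ (by fun_prop) fun w hw h => hz (by
    rwa [sub_eq_zero.1 h]))

/-- The Cauchy transform of the equilibrium measure is holomorphic and zero-free off `K`. -/
theorem IsEquilibriumMeasure.cauchyTransform_ne_zero {q : ℕ → ℂ[X]} (hK : IsCompact K)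
    (hc : IsConnected K) (hpol : ¬ IsPolar K) (hconv : IsPolynomiallyConvex K)
    (hω : IsEquilibriumMeasure ω K) (hdeg : ∀ k, 0 < (q k).natDegree) (hq : RootAvgTendsto q ω) :
    DifferentiableOn ℂ (cauchyTransform ω) Kᶜ ∧ ∀ z ∈ Kᶜ, cauchyTransform ω z ≠ 0 := by
  have hωK := hω.2.1
  have hsK : ω.support ⊆ K := Measure.support_subset_of_isClosed hK.isClosed (mem_ae_iff.2 hωK)
  obtain ⟨p, hmonic, hpdeg, hroots, hlim⟩ := hq.exists_roots_mem_support hK hsK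
  have hpdeg' : ∀ k, 0 < (p k).natDegree := fun k => by rw [hpdeg]; exact hdeg k
  have hKo : IsOpen Kᶜ := hK.isClosed.isOpen_compl
  have hfree : ∀ k, ∀ z ∈ Kᶜ, (p k).eval z ≠ 0 := fun k z hz h =>
    hz (hsK (hroots k z ((mem_roots (hmonic k).ne_zero).2 h)))
  have hconvg := RootAvgTendsto.tendstoLocallyUniformlyOn_cauchyTransform
    (fun g hg _ => hlim g hg) hpdeg' hωK le_rfl hKo disjoint_compl_left
    (Eventually.of_forall hfree)
  have hdiffk : ∀ k, DifferentiableOn ℂ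
      (fun z => (p k).derivative.eval z / ((p k).natDegree * (p k).eval z)) Kᶜ := fun k => by
    refine DifferentiableOn.div (by fun_prop) (by fun_prop) fun z hz => ?_
    exact mul_ne_zero (by exact_mod_cast (hpdeg' k).ne') (hfree k z hz)
  have hdiff : DifferentiableOn ℂ (cauchyTransform ω) Kᶜ :=
    hconvg.differentiableOn (Eventually.of_forall hdiffk) hKo
  refine ⟨hdiff, fun z₀ hz₀ h0 => ?_⟩
  obtain ⟨I, hub, hlb⟩ := hω.potential_bounds hK hc hpol
  have hdist : 0 < Metric.infDist z₀ K :=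
    (hK.isClosed.notMem_iff_infDist_pos hc.nonempty).1 hz₀
  have hSne : ω.support.Nonempty := Measure.nonempty_support (IsProbabilityMeasure.ne_zero ω)
  set δ := Metric.infDist z₀ K / 2 with hδ
  have hδ0 : 0 < δ := by positivity
  have hI : I < truncPotential ω δ z₀ :=
    lt_truncPotential_of_notMem hK hc.nonempty hωK hsK hconv hmonic hpdeg' hroots hlim hlb hz₀
      (by have := Metric.infDist_le_infDist_of_subset hsK hSne (x := z₀); linarith)
  -- The potential at `z₀` is `I + 5 * η` and the level is `c = I + 3 * η`. Near `K` the discrete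
  -- potential is below it: `I + η` on `K`, `η` for leaving `K`, `η` for the limit. Near `z₀` it is
  -- above it, with one `η` lost by continuity and one by the limit.
  set η := (truncPotential ω δ z₀ - I) / 5 with hη
  have hη0 : 0 < η := by rw [hη]; linarith
  obtain ⟨δ₁, hδ₁, hub'⟩ := hub η hη0
  -- The truncated potential is `1 / δ₁`-Lipschitz, so moving by `ε` costs at most `η`.
  set ε := δ₁ * η with hε
  have hε0 : 0 < ε := by positivity
  have hthick : ∀ z, Metric.infDist z K ≤ ε → truncPotential ω δ₁ z ≤ I + 2 * η := by
    intro z hz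
    obtain ⟨y, hy, hyz⟩ := hK.isClosed.exists_infDist_eq_dist hc.nonempty z
    have h1 := hub' δ₁ hδ₁ le_rfl y hy
    have h2 := truncPotential_sub_le hK hωK hδ₁ z y
    rw [hyz, dist_eq_norm] at hz
    have h3 : ‖z - y‖ / δ₁ ≤ η := by rw [div_le_iff₀ hδ₁, mul_comm]; exact hz
    linarith
  have hT := Metric.tendstoUniformlyOn_iff.1 (tendstoUniformlyOn_rootAvg_log_max hK hωK hpdeg' hlim
    hδ₁ (hK.cthickening (r := ε))) η hη0
  obtain ⟨ρ, hρ, hρball⟩ := Metric.continuous_iff.1 (continuous_truncPotential hK hωK hδ0) z₀ η hη0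
  set s := min (ρ / 2) δ with hs
  have hs0 : 0 < s := by positivity
  have hB := Metric.tendstoUniformlyOn_iff.1 (tendstoUniformlyOn_rootAvg_log_max hK hωK hpdeg' hlim
    hδ0 (isCompact_closedBall z₀ s)) η hη0
  have hfar : ∀ z ∈ Metric.closedBall z₀ s, ∀ w ∈ K, δ ≤ ‖z - w‖ := by
    intro z hz w hw
    have h1 := Metric.infDist_le_dist_of_mem (x := z₀) hw
    have h2 := dist_triangle z₀ z w
    have h3 : dist z z₀ ≤ δ := (Metric.mem_closedBall.1 hz).trans (min_le_right _ _)
    rw [dist_comm] at h3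
    rw [← dist_eq_norm]
    linarith
  have hcrit : ∀ᶠ k in atTop, ∀ z ∈ Metric.ball z₀ s,
      (p k).derivative.eval z / ((p k).natDegree * (p k).eval z) ≠ 0 := by
    filter_upwards [hT, hB] with k hk1 hk2 z hz
    have hzc := Metric.ball_subset_closedBall hz
    have hzK : z ∈ Kᶜ := fun hzK => by
      have := hfar z hzc z hzK
      rw [sub_self, norm_zero] at this
      linarith
    refine div_ne_zero ?_ (mul_ne_zero (by exact_mod_cast (hpdeg' k).ne') (hfree k z hzK))
    have hn0 : (0 : ℝ) < (p k).natDegree := by exact_mod_cast hpdeg' k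
    refine derivative_eval_ne_zero_of_exp_lt hc hε0 (hmonic k) (hpdeg' k)
      (fun w hw => hsK (hroots k w hw)) (c := I + 3 * η) (fun y hy => ?_) ?_
    · refine (norm_eval_le_exp (hmonic k) (hpdeg' k) hδ₁ y).trans ?_
      rw [← Real.exp_nat_mul]
      refine Real.exp_le_exp.2 (mul_le_mul_of_nonneg_left ?_ hn0.le)
      have h1 := hk1 y ((mem_cthickening_iff_infDist_le hc.nonempty hε0.le).2 hy)
      rw [Real.dist_eq] at h1
      have h2 := (abs_lt.1 h1).1
      have h3 := hthick y hy
      linarith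
    · rw [norm_eval_eq_exp (hmonic k) (hpdeg' k) hδ0
        fun w hw => hfar z hzc w (hsK (hroots k w hw)), ← Real.exp_nat_mul]
      refine Real.exp_lt_exp.2 (mul_lt_mul_of_pos_left ?_ hn0)
      have h1 := hk2 z hzc
      have h2 := hρball z (by
        have : s ≤ ρ / 2 := min_le_left _ _
        have := Metric.mem_ball.1 hz
        linarith)
      rw [Real.dist_eq] at h1 h2
      have h3 := (abs_lt.1 h1).2
      have h4 := (abs_lt.1 h2).1
      have h5 : truncPotential ω δ z₀ = I + 5 * η := by rw [hη]; ring
      linarith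
  have hballK : Metric.ball z₀ s ⊆ Kᶜ := fun z hz hzK => by
    have := hfar z (Metric.ball_subset_closedBall hz) z hzK
    rw [sub_self, norm_zero] at this
    linarith
  have hloc := eventually_eq_zero_of_tendstoLocallyUniformlyOn Metric.isOpen_ball
    (hconvg.mono hballK) (Eventually.of_forall fun k => (hdiffk k).mono hballK) hcrit
    (Metric.mem_ball_self hs0) h0
  set V := connectedComponentIn Kᶜ z₀ with hV
  have hVK : V ⊆ Kᶜ := connectedComponentIn_subset _ _
  have hzero : ∀ z ∈ V, cauchyTransform ω z = 0 :=
    ((hdiff.analyticOnNhd hKo).mono hVK).eqOn_zero_of_preconnected_of_eventuallyEq_zero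
      isPreconnected_connectedComponentIn (mem_connectedComponentIn hz₀) hloc
  obtain ⟨R₀, hR₀⟩ := hK.isBounded.exists_norm_le
  have hunb := not_isBounded_connectedComponentIn_compl hK hconv hz₀
  rw [isBounded_iff_forall_norm_le] at hunb
  push Not at hunb
  obtain ⟨z, hzV, hz⟩ := hunb (max 0 (2 * R₀))
  exact cauchyTransform_ne_zero_of_large hωK hR₀ ((le_max_right _ _).trans_lt hz)
    ((le_max_left _ _).trans_lt hz) (integrable_inv_sub hK hωK (hVK hzV)) (hzero z hzV)

end connected

/-! ### Divisors as sums over roots -/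

section divisor

lemma analyticOrderAt_eval {p : ℂ[X]} (hp : p ≠ 0) (z : ℂ) :
    analyticOrderAt (fun x => p.eval x) z = p.rootMultiplicity z := by
  obtain ⟨r, hr, hdvd⟩ := exists_eq_pow_rootMultiplicity_mul_and_not_dvd p hp z
  rw [AnalyticAt.analyticOrderAt_eq_natCast (Differentiable.analyticAt (by fun_prop) z)]
  refine ⟨fun x => r.eval x, Differentiable.analyticAt (by fun_prop) z, fun h => ?_,
    Eventually.of_forall fun x => ?_⟩
  · exact hdvd (dvd_iff_isRoot.2 h)
  · conv_lhs => rw [hr]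
    simp

lemma polyDivisor_apply {U : Set ℂ} {p : ℂ[X]} (hp : p ≠ 0) {z : ℂ} (hz : z ∈ U) :
    polyDivisor U p z = p.rootMultiplicity z := by
  unfold polyDivisor
  rw [MeromorphicOn.AnalyticOnNhd.divisor_apply
    (fun x _ => Differentiable.analyticAt (by fun_prop) x) hz, analyticOrderAt_eval hp]
  rfl

lemma sum_roots_map_eq_sum_rootMultiplicity (p : ℂ[X]) (f : ℂ → ℂ) {s : Finset ℂ}
    (hs : p.roots.toFinset ⊆ s) :
    (p.roots.map f).sum = ∑ z ∈ s, (p.rootMultiplicity z : ℂ) * f z := by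
  rw [Finset.sum_multiset_map_count]
  refine (Finset.sum_subset hs fun z _ hz => ?_).trans
    (Finset.sum_congr rfl fun z _ => by rw [count_roots, nsmul_eq_mul])
  rw [Multiset.mem_toFinset] at hz
  rw [Multiset.count_eq_zero_of_notMem hz, zero_smul]

/-- The pairing becomes a finite sum over all roots in the plane: those outside `U` contribute
nothing, as `f` vanishes there. -/
lemma divisorPairing_polyDivisor_sub {U : Set ℂ} {p q : ℂ[X]} (hp : p ≠ 0) (hq : q ≠ 0)
    {f : ℂ → ℂ} (hf : ∀ z, z ∉ U → f z = 0) :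
    divisorPairing (polyDivisor U p - polyDivisor U q) f =
      (p.roots.map f).sum - (q.roots.map f).sum := by
  set s := p.roots.toFinset ∪ q.roots.toFinset
  rw [sum_roots_map_eq_sum_rootMultiplicity p f Finset.subset_union_left,
    sum_roots_map_eq_sum_rootMultiplicity q f Finset.subset_union_right, ← Finset.sum_sub_distrib]
  have hterm : ∀ z, (((polyDivisor U p - polyDivisor U q) z : ℤ) : ℂ) * f z =
      (p.rootMultiplicity z : ℂ) * f z - (q.rootMultiplicity z : ℂ) * f z := by
    intro z
    by_cases hz : z ∈ U
    · rw [Function.locallyFinsuppWithin.coe_sub, Pi.sub_apply, polyDivisor_apply hp hz,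
        polyDivisor_apply hq hz]
      push_cast
      ring
    · simp [hf z hz]
  unfold divisorPairing
  simp only [hterm]
  refine finsum_eq_sum_of_support_subset _ fun z hz => ?_
  by_contra hzs
  apply hz
  have h0 : ∀ r : ℂ[X], z ∉ r.roots.toFinset → r.rootMultiplicity z = 0 := fun r hr => by
    rw [Multiset.mem_toFinset] at hr
    rw [← count_roots, Multiset.count_eq_zero_of_notMem hr]
  simp [h0 p fun h => hzs (Finset.mem_coe.2 (Finset.mem_union_left _ h)),
    h0 q fun h => hzs (Finset.mem_coe.2 (Finset.mem_union_right _ h))]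

end divisor

/-! ### Root counts and the argument principle -/

section count

open Classical in
/-- The number of roots of a polynomial in a set, with multiplicity. -/
noncomputable def rootCount (p : ℂ[X]) (B : Set ℂ) : ℕ := p.roots.countP (· ∈ B)

lemma rootCountingMeasure_apply (p : ℂ[X]) {B : Set ℂ} (hB : MeasurableSet B) :
    rootCountingMeasure p B = rootCount p B := by
  classical
  unfold rootCountingMeasure rootCount
  generalize p.roots = s
  induction s using Multiset.induction with
  | empty => simp
  | cons a s ih =>
    rw [Multiset.map_cons, Multiset.sum_cons, Measure.add_apply, ih, Measure.dirac_apply' _ hB,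
      Multiset.countP_cons]
    by_cases h : a ∈ B <;> simp [h, add_comm]

lemma sum_roots_indicator {E : Type*} [CommSemiring E] (p : ℂ[X]) (B : Set ℂ) (c : E) :
    (p.roots.map (B.indicator fun _ => c)).sum = rootCount p B * c := by
  classical
  unfold rootCount
  generalize p.roots = s
  induction s using Multiset.induction with
  | empty => simp
  | cons a s ih =>
    rw [Multiset.map_cons, Multiset.sum_cons, ih, Multiset.countP_cons]
    by_cases h : a ∈ B <;> simp [h]; ring

lemma rootCount_mono (p : ℂ[X]) {B B' : Set ℂ} (h : B ⊆ B') : rootCount p B ≤ rootCount p B' := by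
  classical
  unfold rootCount
  rw [Multiset.countP_eq_card_filter, Multiset.countP_eq_card_filter]
  exact Multiset.card_le_card (Multiset.monotone_filter_right _ fun a ha => h ha)

lemma card_le_rootCount {p : ℂ[X]} {B : Set ℂ} {t : Finset ℂ} (h : ∀ w ∈ t, w ∈ p.roots ∧ w ∈ B) :
    t.card ≤ rootCount p B := by
  classical
  unfold rootCount
  rw [Multiset.countP_eq_card_filter]
  refine Multiset.card_le_card ((Multiset.le_iff_subset t.nodup).2 fun w hw => ?_)
  exact Multiset.mem_filter.2 (h w hw)

/-- The argument principle for a polynomial on a circle. -/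
lemma circleIntegral_logDeriv_eval {p : ℂ[X]} {a : ℂ} {r : ℝ} (hr : 0 < r)
    (hp : ∀ z ∈ Metric.sphere a r, p.eval z ≠ 0) :
    (∮ z in C(a, r), p.derivative.eval z / p.eval z) =
      rootCount p (Metric.ball a r) * (2 * Real.pi * Complex.I) := by
  classical
  by_cases hp0 : p = 0
  · obtain ⟨z, hz⟩ := NormedSpace.sphere_nonempty (x := a).2 hr.le
    exact absurd (by simp [hp0]) (hp z hz)
  have hs : ∀ w ∈ p.roots, w ∉ Metric.sphere a r := fun w hw h =>
    hp w h ((mem_roots hp0).1 hw)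
  have e : (∮ z in C(a, r), p.derivative.eval z / p.eval z) =
      ∮ z in C(a, r), (p.roots.map fun w => (z - w)⁻¹).sum := by
    refine circleIntegral.integral_congr hr.le fun z hz => ?_
    have := (IsAlgClosed.splits p).eval_derivative_div_eval_of_ne_zero (hp z hz)
    simpa only [one_div] using this
  rw [e]
  unfold rootCount
  generalize p.roots = s at hs
  suffices h : ContinuousOn (fun z => (s.map fun w => (z - w)⁻¹).sum) (Metric.sphere a r) ∧
      (∮ z in C(a, r), (s.map fun w => (z - w)⁻¹).sum) =
        (s.countP (· ∈ Metric.ball a r) : ℂ) * (2 * Real.pi * Complex.I) from h.2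
  induction s using Multiset.induction with
  | empty => simp [circleIntegral]; exact continuousOn_const
  | cons w s ih =>
    obtain ⟨hc, hi⟩ := ih fun w hw => hs w (Multiset.mem_cons_of_mem hw)
    have hw := hs w (Multiset.mem_cons_self w s)
    have hcw : ContinuousOn (fun z => (z - w)⁻¹) (Metric.sphere a r) :=
      ContinuousOn.inv₀ (by fun_prop) fun z hz h => hw (by rwa [← sub_eq_zero.1 h])
    have hone : (∮ z in C(a, r), (z - w)⁻¹) =
        (if w ∈ Metric.ball a r then 1 else 0) * (2 * Real.pi * Complex.I) := by
      split_ifs with h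
      · rw [one_mul]; exact circleIntegral.integral_sub_inv_of_mem_ball h
      · rw [zero_mul]
        refine DiffContOnCl.circleIntegral_eq_zero hr.le (DifferentiableOn.diffContOnCl ?_)
        rw [closure_ball a hr.ne']
        refine DifferentiableOn.inv (by fun_prop) fun z hz h0 => ?_
        rw [sub_eq_zero.1 h0] at hz
        rcases (Metric.mem_closedBall.1 hz).lt_or_eq with h1 | h1
        · exact h h1
        · exact hw h1
    simp only [Multiset.map_cons, Multiset.sum_cons]
    refine ⟨hcw.add hc, ?_⟩
    rw [circleIntegral.integral_add (hcw.circleIntegrable hr.le) (hc.circleIntegrable hr.le), hi,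
      hone, Multiset.countP_cons]
    push_cast
    ring

end count

/-! ### Quotients of derivatives by the polynomial -/

section derivatives

lemma natDegree_iterate_derivative_eq (p : ℂ[X]) (m : ℕ) :
    (derivative^[m] p).natDegree = p.natDegree - m := by
  induction m with
  | zero => simp
  | succ m ih => rw [Function.iterate_succ_apply', natDegree_derivative, ih, Nat.sub_sub]

variable {K : Set ℂ} {ω : Measure ℂ} [IsProbabilityMeasure ω] {q : ℕ → ℂ[X]} {l : Filter ℕ}

/-- The quotient of the `m`-th derivative by the polynomial, normalised by the degree. -/
noncomputable def derivQuotient (p : ℂ[X]) (m : ℕ) (z : ℂ) : ℂ :=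
  (derivative^[m] p).eval z / ((p.natDegree : ℂ) ^ m * p.eval z)

lemma differentiableOn_derivQuotient {p : ℂ[X]} (hdeg : 0 < p.natDegree) (m : ℕ) {O : Set ℂ}
    (h : ∀ z ∈ O, p.eval z ≠ 0) : DifferentiableOn ℂ (derivQuotient p m) O := by
  have hn : (p.natDegree : ℂ) ≠ 0 := by exact_mod_cast hdeg.ne'
  exact DifferentiableOn.div (by fun_prop) (by fun_prop) fun z hz =>
    mul_ne_zero (pow_ne_zero _ hn) (h z hz)

lemma deriv_derivQuotient {p : ℂ[X]} (hdeg : 0 < p.natDegree) (m : ℕ) {z : ℂ}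
    (h : p.eval z ≠ 0) :
    deriv (derivQuotient p m) z =
      ((derivative^[m + 1] p).eval z * p.eval z - (derivative^[m] p).eval z * p.derivative.eval z) /
        ((p.natDegree : ℂ) ^ m * p.eval z ^ 2) := by
  have hn : (p.natDegree : ℂ) ≠ 0 := by exact_mod_cast hdeg.ne'
  have h1 : HasDerivAt (derivQuotient p m) _ z := HasDerivAt.div ((derivative^[m] p).hasDerivAt z)
    ((p.hasDerivAt z).const_mul ((p.natDegree : ℂ) ^ m)) (mul_ne_zero (pow_ne_zero _ hn) h)
  rw [h1.deriv, Function.iterate_succ_apply']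
  field_simp

/-- Induction on `F_{m+1} = F_m' / n + F_m * F_1`. Locally uniform limits of holomorphic functions
may be differentiated, so `F_m'` converges and the factor `1 / n` removes it in the limit. -/
lemma RootAvgTendsto.tendstoLocallyUniformlyOn_derivQuotient (hq : RootAvgTendsto q ω)
    (hdeg : ∀ k, 0 < (q k).natDegree)
    (hdegt : Tendsto (fun k => (q k).natDegree) atTop atTop) (hωK : ω Kᶜ = 0)
    (hC : DifferentiableOn ℂ (cauchyTransform ω) Kᶜ) (hl : l ≤ atTop) {O : Set ℂ}
    (hO : IsOpen O) (hOK : O ⊆ Kᶜ) (hfree : ∀ᶠ k in l, ∀ z ∈ O, (q k).eval z ≠ 0) (m : ℕ) :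
    TendstoLocallyUniformlyOn (fun k => derivQuotient (q k) m)
      (fun z => cauchyTransform ω z ^ m) l O := by
  have hCO := hC.mono hOK
  have hbase := hq.tendstoLocallyUniformlyOn_cauchyTransform hdeg hωK hl hO
    (Set.disjoint_left.2 fun z hz hzK => hOK hz hzK) hfree
  induction m with
  | zero =>
    intro u hu x hx
    refine ⟨O, self_mem_nhdsWithin, ?_⟩
    filter_upwards [hfree] with k hk y hy
    have : derivQuotient (q k) 0 y = 1 := by
      simp [derivQuotient, hk y hy]
    simp only [pow_zero]
    rw [this]
    exact refl_mem_uniformity hu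
  | succ m ih =>
    have hd : ∀ᶠ k in l, DifferentiableOn ℂ (derivQuotient (q k) m) O := by
      filter_upwards [hfree] with k hk using differentiableOn_derivQuotient (hdeg k) m hk
    have h1 := ih.deriv hd hO
    have hinv : Tendsto (fun k => ((q k).natDegree : ℂ)⁻¹) l (𝓝 0) :=
      ((tendsto_inv_atTop_nhds_zero_nat (𝕜 := ℂ)).comp hdegt).mono_left hl
    have h2 : TendstoLocallyUniformlyOn (fun k (_ : ℂ) => ((q k).natDegree : ℂ)⁻¹)
        (fun _ => 0) l O := (hinv.tendstoUniformlyOn_const O).tendstoLocallyUniformlyOn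
    have hCm : DifferentiableOn ℂ (fun z => cauchyTransform ω z ^ m) O := hCO.pow m
    have h3 := h2.mul₀ h1 continuousOn_const (hCm.deriv hO).continuousOn
    have h4 := ih.mul₀ hbase hCm.continuousOn hCO.continuousOn
    have h5 := h3.add h4
    refine (h5.congr_inseparable ?_).congr_right fun z _ => ?_
    · filter_upwards [hfree] with k hk z hz
      refine Inseparable.of_eq ?_
      have hn : ((q k).natDegree : ℂ) ≠ 0 := by exact_mod_cast (hdeg k).ne'
      have hz' := hk z hz
      simp only [Pi.add_apply, Pi.mul_apply, Function.comp_apply]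
      rw [deriv_derivQuotient (hdeg k) m hz']
      unfold derivQuotient
      field_simp
      ring
    · simp only [Pi.add_apply, Pi.mul_apply]
      ring

/-- Near a compact set on which a continuous limit has no zeros, locally uniform approximants have no
zeros. -/
lemma eventually_forall_ne_zero {F : ℕ → ℂ → ℂ} {f : ℂ → ℂ} {O Z : Set ℂ} (hO : IsOpen O)
    (h : TendstoLocallyUniformlyOn F f l O) (hf : ContinuousOn f O) (hZ : IsCompact Z)
    (hZO : Z ⊆ O) (hne : ∀ z ∈ Z, f z ≠ 0) : ∀ᶠ k in l, ∀ z ∈ Z, F k z ≠ 0 := by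
  rcases Z.eq_empty_or_nonempty with rfl | hZne
  · simp
  obtain ⟨y, hy, hmin⟩ := hZ.exists_isMinOn hZne (hf.mono hZO).norm
  have hunif := (tendstoLocallyUniformlyOn_iff_forall_isCompact hO).1 h _ hZO hZ
  filter_upwards [Metric.tendstoUniformlyOn_iff.1 hunif ‖f y‖ (norm_pos_iff.2 (hne y hy))]
    with k hk z hz h0
  have h1 := hk z hz
  rw [h0, dist_zero_right] at h1
  exact absurd (hmin hz) (not_le.2 h1)

/-- The derivatives have as many roots as the polynomials in a disc whose boundary circle stays away
from the roots. -/
lemma RootAvgTendsto.eventually_rootCount_eq (hq : RootAvgTendsto q ω)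
    (hdeg : ∀ k, 0 < (q k).natDegree)
    (hdegt : Tendsto (fun k => (q k).natDegree) atTop atTop) (hK : IsCompact K) (hωK : ω Kᶜ = 0)
    (hC : DifferentiableOn ℂ (cauchyTransform ω) Kᶜ) (hC0 : ∀ z ∈ Kᶜ, cauchyTransform ω z ≠ 0)
    (hl : l ≤ atTop) {O : Set ℂ} (hO : IsOpen O) (hOK : O ⊆ Kᶜ)
    (hfree : ∀ᶠ k in l, ∀ z ∈ O, (q k).eval z ≠ 0) (m : ℕ) {a : ℂ} {r : ℝ} (hr : 0 < r)
    (hsph : Metric.sphere a r ⊆ O) (hball : Metric.closedBall a r ⊆ Kᶜ) :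
    ∀ᶠ k in l, rootCount (derivative^[m] (q k)) (Metric.ball a r) =
      rootCount (q k) (Metric.ball a r) := by
  have hKo : IsOpen Kᶜ := hK.isClosed.isOpen_compl
  set c : ℂ → ℂ := fun z => cauchyTransform ω z ^ m with hc
  have hcd : DifferentiableOn ℂ c Kᶜ := hC.pow m
  have hc0 : ∀ z ∈ Kᶜ, c z ≠ 0 := fun z hz => pow_ne_zero _ (hC0 z hz)
  have h1 := hq.tendstoLocallyUniformlyOn_derivQuotient hdeg hdegt hωK hC hl hO hOK hfree m
  have hd : ∀ᶠ k in l, DifferentiableOn ℂ (derivQuotient (q k) m) O := by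
    filter_upwards [hfree] with k hk using differentiableOn_derivQuotient (hdeg k) m hk
  -- The logarithmic derivative of `F_m` is the difference of those of `q_k^(m)` and `q_k`. Its
  -- limit `c' / c` has zero integral because `c` is zero-free on the closed disc.
  have h2 := (h1.deriv hd hO).div₀ h1 ((hcd.mono hOK).deriv hO).continuousOn
    (hcd.mono hOK).continuousOn fun z hz => hc0 z (hOK hz)
  have hne := eventually_forall_ne_zero hO h1 (hcd.mono hOK).continuousOn (isCompact_sphere a r)
    hsph fun z hz => hc0 z (hOK (hsph hz))
  have hunif := (tendstoLocallyUniformlyOn_iff_forall_isCompact hO).1 h2 _ hsph (isCompact_sphere a r)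
  have hlim0 : (∮ z in C(a, r), deriv c z / c z) = 0 := by
    refine DiffContOnCl.circleIntegral_eq_zero hr.le (DifferentiableOn.diffContOnCl ?_)
    rw [closure_ball a hr.ne']
    exact ((hcd.deriv hKo).mono hball).div (hcd.mono hball) fun z hz => hc0 z (hball hz)
  have hlimc : CircleIntegrable (fun z => deriv c z / c z) a r :=
    (((hcd.deriv hKo).continuousOn.div hcd.continuousOn hc0).mono
      (hsph.trans hOK)).circleIntegrable hr.le
  -- With error `1 / (2 * r)` the integrals differ by at most `π`, half of `2π`, so the integer root
  -- counts differ by less than `1`.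
  filter_upwards [hfree, hne, Metric.tendstoUniformlyOn_iff.1 hunif (1 / (2 * r)) (by positivity)]
    with k hk hk0 hkd
  set p := derivative^[m] (q k) with hp
  have hn : ((q k).natDegree : ℂ) ≠ 0 := by exact_mod_cast (hdeg k).ne'
  have hq0 : ∀ z ∈ Metric.sphere a r, (q k).eval z ≠ 0 := fun z hz => hk z (hsph hz)
  have hp0 : ∀ z ∈ Metric.sphere a r, p.eval z ≠ 0 := fun z hz h =>
    hk0 z hz (by unfold derivQuotient; rw [← hp, h, zero_div])
  have hpc : CircleIntegrable (fun z => p.derivative.eval z / p.eval z) a r :=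
    (ContinuousOn.div (by fun_prop) (by fun_prop) hp0).circleIntegrable hr.le
  have hqc : CircleIntegrable (fun z => (q k).derivative.eval z / (q k).eval z) a r :=
    (ContinuousOn.div (by fun_prop) (by fun_prop) hq0).circleIntegrable hr.le
  have hpt : ∀ z ∈ Metric.sphere a r, ‖(p.derivative.eval z / p.eval z -
      (q k).derivative.eval z / (q k).eval z) - deriv c z / c z‖ ≤ 1 / (2 * r) := by
    intro z hz
    have h3 := (hkd z hz).le
    rw [dist_comm, dist_eq_norm] at h3
    change ‖deriv (derivQuotient (q k) m) z / derivQuotient (q k) m z - deriv c z / c z‖ ≤ _ at h3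
    have h4 := hq0 z hz
    have h5 := hp0 z hz
    have e : deriv (derivQuotient (q k) m) z / derivQuotient (q k) m z =
        p.derivative.eval z / p.eval z - (q k).derivative.eval z / (q k).eval z := by
      rw [deriv_derivQuotient (hdeg k) m h4]
      unfold derivQuotient
      rw [Function.iterate_succ_apply', ← hp]
      field_simp
    rwa [e] at h3
  have h6 := circleIntegral.norm_integral_le_of_norm_le_const hr.le hpt
  have hpqc : CircleIntegrable (fun z => p.derivative.eval z / p.eval z -
      (q k).derivative.eval z / (q k).eval z) a r := hpc.sub hqc
  rw [circleIntegral.integral_sub hpqc hlimc, circleIntegral.integral_sub hpc hqc, hlim0,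
    sub_zero, circleIntegral_logDeriv_eval hr hp0, circleIntegral_logDeriv_eval hr hq0, ← sub_mul,
    norm_mul] at h6
  have h7 : ‖(2 * Real.pi * Complex.I : ℂ)‖ = 2 * Real.pi := by
    simp [abs_of_pos Real.pi_pos]
  have h8 : 2 * Real.pi * r * (1 / (2 * r)) = Real.pi := by field_simp
  rw [h7, h8] at h6
  have h9 : ‖((rootCount p (Metric.ball a r) : ℂ) - rootCount (q k) (Metric.ball a r))‖ < 1 := by
    by_contra! hge
    nlinarith [Real.pi_pos]
  have h10 : ‖(((rootCount p (Metric.ball a r) : ℤ) - rootCount (q k) (Metric.ball a r) : ℤ) : ℂ)‖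
      < 1 := by push_cast; exact h9
  rw [Complex.norm_intCast] at h10
  have h11 : |((rootCount p (Metric.ball a r) : ℤ) - rootCount (q k) (Metric.ball a r))| < 1 := by
    exact_mod_cast h10
  have := Int.abs_lt_one_iff.1 h11
  omega

end derivatives

/-! ### Limit points of roots along an ultrafilter -/

section accumulation

variable {q : ℕ → ℂ[X]} {𝒰 : Ultrafilter ℕ}

/-- The points near which the polynomials have roots along the ultrafilter. -/
def rootLimits (q : ℕ → ℂ[X]) (𝒰 : Ultrafilter ℕ) : Set ℂ :=
  {a | ∀ r > 0, ∀ᶠ k in (𝒰 : Filter ℕ), ∃ w ∈ (q k).roots, w ∈ Metric.ball a r}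

/-- Along an ultrafilter, failing to have roots in a disc eventually means having none there
eventually. Compactness passes from discs to `C`. -/
lemma exists_isOpen_rootFree (hq0 : ∀ k, q k ≠ 0) {U C : Set ℂ} (hU : IsOpen U) (hC : IsCompact C)
    (hCU : C ⊆ U) (hCA : Disjoint C (rootLimits q 𝒰)) :
    ∃ O, IsOpen O ∧ C ⊆ O ∧ O ⊆ U ∧ ∀ᶠ k in (𝒰 : Filter ℕ), ∀ z ∈ O, (q k).eval z ≠ 0 := by
  refine hC.induction_on (p := fun s => ∃ O, IsOpen O ∧ s ⊆ O ∧ O ⊆ U ∧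
    ∀ᶠ k in (𝒰 : Filter ℕ), ∀ z ∈ O, (q k).eval z ≠ 0) ?_ ?_ ?_ ?_
  · exact ⟨∅, isOpen_empty, le_rfl, Set.empty_subset _, by simp⟩
  · rintro s t hst ⟨O, h1, h2, h3⟩
    exact ⟨O, h1, hst.trans h2, h3⟩
  · rintro s t ⟨O, h1, h2, h3, h4⟩ ⟨O', h1', h2', h3', h4'⟩
    refine ⟨O ∪ O', h1.union h1', Set.union_subset_union h2 h2', Set.union_subset h3 h3', ?_⟩
    filter_upwards [h4, h4'] with k hk hk' z hz
    exact hz.elim (hk z) (hk' z)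
  · intro x hx
    have hxA : x ∉ rootLimits q 𝒰 := Set.disjoint_left.1 hCA hx
    simp only [rootLimits, Set.mem_ofPred_eq, not_forall] at hxA
    obtain ⟨r, hr, h⟩ := hxA
    rw [← Ultrafilter.eventually_not] at h
    refine ⟨Metric.ball x r ∩ U, mem_nhdsWithin_of_mem_nhds
      (inter_mem (Metric.ball_mem_nhds x hr) (hU.mem_nhds (hCU hx))),
      Metric.ball x r ∩ U, Metric.isOpen_ball.inter hU, le_rfl, Set.inter_subset_right, ?_⟩
    filter_upwards [h] with k hk z hz hz0
    exact hk ⟨z, (mem_roots (hq0 k)).2 hz0, hz.1⟩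

lemma eventually_two_mul_lt_dist {t : Set ℂ} (ht : t.Finite) :
    ∀ᶠ r : ℝ in 𝓝[>] 0, ∀ a ∈ t, ∀ b ∈ t, a ≠ b → 2 * r < dist a b := by
  rw [ht.eventually_all]
  intro a _
  rw [ht.eventually_all]
  intro b _
  by_cases hab : a = b
  · simp [hab]
  · have h : Tendsto (fun r : ℝ => 2 * r) (𝓝[>] 0) (𝓝 0) := by
      have : Tendsto (fun r : ℝ => 2 * r) (𝓝 0) (𝓝 (2 * 0)) := by
        exact (continuous_const.mul continuous_id).tendsto 0
      rw [mul_zero] at this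
      exact this.mono_left nhdsWithin_le_nhds
    filter_upwards [h.eventually (gt_mem_nhds (dist_pos.2 hab))] with r hr _ using hr

lemma eventually_closedBall_subset {U : Set ℂ} (hU : IsOpen U) {a : ℂ} (ha : a ∈ U) :
    ∀ᶠ r : ℝ in 𝓝[>] 0, Metric.closedBall a r ⊆ U := by
  obtain ⟨ε, hε, h⟩ := Metric.nhds_basis_closedBall.mem_iff.1 (hU.mem_nhds ha)
  filter_upwards [Ioc_mem_nhdsGT hε] with r hr
  exact (Metric.closedBall_subset_closedBall hr.2).trans h

/-- `M + 1` limit points would have disjoint discs inside `U`, each containing a root for a common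
`k`. -/
lemma finite_rootLimits_inter {U C : Set ℂ} {M : ℕ} (hU : IsOpen U) (hCU : U ⊆ C)
    (hM : ∀ᶠ k in (𝒰 : Filter ℕ), rootCount (q k) C ≤ M) : (rootLimits q 𝒰 ∩ U).Finite := by
  by_contra hinf
  obtain ⟨t, htA, htc⟩ := Set.Infinite.exists_subset_card_eq hinf (M + 1)
  have hev : ∀ᶠ r : ℝ in 𝓝[>] 0, ∀ a ∈ (t : Set ℂ), Metric.closedBall a r ⊆ U :=
    t.finite_toSet.eventually_all.2 fun a ha => eventually_closedBall_subset hU (htA ha).2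
  obtain ⟨r, ⟨hr1, hr2⟩, hr0⟩ :=
    ((hev.and (eventually_two_mul_lt_dist t.finite_toSet)).and self_mem_nhdsWithin).exists
  have hroot : ∀ᶠ k in (𝒰 : Filter ℕ), ∀ a ∈ (t : Set ℂ), ∃ w ∈ (q k).roots, w ∈ Metric.ball a r :=
    t.finite_toSet.eventually_all.2 fun a ha => (htA ha).1 r hr0
  obtain ⟨k, hk1, hk2⟩ := (hM.and hroot).exists
  choose! w hw1 hw2 using hk2
  have hinj : Set.InjOn w (t : Set ℂ) := by
    intro a ha b hb hab
    by_contra hne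
    have h1 := hr2 a ha b hb hne
    have h2 := Metric.mem_ball.1 (hw2 a ha)
    have h3 := Metric.mem_ball.1 (hw2 b hb)
    rw [← hab] at h3
    have := dist_triangle_left a b (w a)
    linarith
  have hle := card_le_rootCount (p := q k) (B := C) (t := t.image w) (by
    intro x hx
    obtain ⟨a, ha, rfl⟩ := Finset.mem_image.1 hx
    exact ⟨hw1 a ha, hCU (hr1 a ha (Metric.ball_subset_closedBall (hw2 a ha)))⟩)
  rw [Finset.card_image_of_injOn hinj] at hle
  omega

/-- A sum over roots compared with the root counts in small disjoint discs that contain all roots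
in the support. -/
lemma norm_sum_roots_sub_le {p : ℂ[X]} {f : ℂ → ℂ} {T : Finset ℂ} {r ε : ℝ} (hε : 0 ≤ ε)
    (hsep : ∀ a ∈ T, ∀ b ∈ T, a ≠ b → 2 * r < dist a b)
    (hosc : ∀ a ∈ T, ∀ z ∈ Metric.ball a r, ‖f z - f a‖ ≤ ε)
    (hout : ∀ z ∈ p.roots, (∀ a ∈ T, z ∉ Metric.ball a r) → f z = 0) :
    ‖(p.roots.map f).sum - ∑ a ∈ T, (rootCount p (Metric.ball a r) : ℂ) * f a‖ ≤
      ε * ∑ a ∈ T, (rootCount p (Metric.ball a r) : ℝ) := by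
  have h1 : ∑ a ∈ T, (rootCount p (Metric.ball a r) : ℂ) * f a =
      (p.roots.map fun z => ∑ a ∈ T, (Metric.ball a r).indicator (fun _ => f a) z).sum := by
    simp only [← sum_roots_indicator]
    exact Multiset.sum_map_sum_map T.1 p.roots
  have h2 : ε * ∑ a ∈ T, (rootCount p (Metric.ball a r) : ℝ) =
      (p.roots.map fun z => ∑ a ∈ T, (Metric.ball a r).indicator (fun _ => ε) z).sum := by
    rw [Finset.mul_sum]
    simp only [mul_comm ε, ← sum_roots_indicator]
    exact Multiset.sum_map_sum_map T.1 p.roots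
  -- The counts are now sums over the roots, so the comparison is termwise; separation puts each
  -- root in at most one disc.
  rw [h1, h2, ← Multiset.sum_map_sub]
  refine (norm_multiset_sum_le _).trans ?_
  rw [Multiset.map_map]
  refine Multiset.sum_map_le_sum_map _ _ fun z hz => ?_
  simp only [Function.comp_apply]
  by_cases h : ∃ a ∈ T, z ∈ Metric.ball a r
  · obtain ⟨a, ha, hza⟩ := h
    have hother : ∀ b ∈ T, b ≠ a → z ∉ Metric.ball b r := fun b hb hba hzb => by
      have h3 := hsep b hb a ha hba
      have h4 := Metric.mem_ball.1 hza
      have h5 := Metric.mem_ball.1 hzb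
      have := dist_triangle_left b a z
      linarith
    rw [Finset.sum_eq_single_of_mem a ha fun b hb hba =>
        Set.indicator_of_notMem (hother b hb hba) _,
      Finset.sum_eq_single_of_mem a ha fun b hb hba =>
        Set.indicator_of_notMem (hother b hb hba) _,
      Set.indicator_of_mem hza, Set.indicator_of_mem hza]
    exact hosc a ha z hza
  · push Not at h
    rw [hout z hz h, Finset.sum_eq_zero fun a ha => Set.indicator_of_notMem (h a ha) _, sub_zero,
      norm_zero]
    exact Finset.sum_nonneg fun a _ => Set.indicator_nonneg (fun _ _ => hε) _

end accumulation

/-- The sums over the roots of the derivatives and of the polynomials agree in the limit along an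
ultrafilter. -/
lemma RootAvgTendsto.tendsto_sum_roots_sub {K : Set ℂ} {ω : Measure ℂ} [IsProbabilityMeasure ω]
    {q : ℕ → ℂ[X]} {𝒰 : Ultrafilter ℕ} (hq : RootAvgTendsto q ω)
    (hdeg : ∀ k, 0 < (q k).natDegree)
    (hdegt : Tendsto (fun k => (q k).natDegree) atTop atTop) (hK : IsCompact K) (hωK : ω Kᶜ = 0)
    (hC : DifferentiableOn ℂ (cauchyTransform ω) Kᶜ) (hC0 : ∀ z ∈ Kᶜ, cauchyTransform ω z ≠ 0)
    (hsparse : IsRootSparse q Kᶜ) (h𝒰 : (𝒰 : Filter ℕ) ≤ atTop) (m : ℕ) {f : ℂ → ℂ}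
    (hf : Continuous f) (hfc : HasCompactSupport f) (hfK : tsupport f ⊆ Kᶜ) :
    Tendsto (fun k => ((derivative^[m] (q k)).roots.map f).sum - ((q k).roots.map f).sum)
      (𝒰 : Filter ℕ) (𝓝 0) := by
  have hKo : IsOpen Kᶜ := hK.isClosed.isOpen_compl
  have hq0 : ∀ k, q k ≠ 0 := fun k h => by have := hdeg k; rw [h, natDegree_zero] at this; omega
  -- A compact neighbourhood of the support leaves room for discs about the limit points on the
  -- support, within the region where the root count is bounded.
  obtain ⟨C, hCc, hSC, hCK⟩ := exists_compact_between hfc hKo hfK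
  obtain ⟨M, hM⟩ := hsparse.2 C hCc hCK
  have hM' : ∀ᶠ k in (𝒰 : Filter ℕ), rootCount (q k) C ≤ M := by
    filter_upwards [h𝒰 hM] with k hk
    rw [rootCountingMeasure_apply _ hCc.measurableSet] at hk
    exact_mod_cast hk
  set A := rootLimits q 𝒰 with hA
  have hfin : (A ∩ interior C).Finite := finite_rootLimits_inter isOpen_interior interior_subset hM'
  set T := hfin.toFinset with hT
  have hTC : ∀ a ∈ T, a ∈ A ∧ a ∈ interior C := fun a ha => hfin.mem_toFinset.1 ha
  rw [Metric.tendsto_nhds]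
  intro ε hε
  -- The discs hold at most `T.card * M` counted roots, so each of the two comparisons with the disc
  -- counts costs less than `ε / 2`.
  set η := ε / (2 * (T.card * M + 1)) with hη
  have hη0 : 0 < η := by positivity
  have hev1 : ∀ᶠ r : ℝ in 𝓝[>] 0, ∀ a ∈ (T : Set ℂ), Metric.closedBall a r ⊆ interior C :=
    T.finite_toSet.eventually_all.2 fun a ha =>
      eventually_closedBall_subset isOpen_interior (hTC a ha).2
  have hev2 : ∀ᶠ r : ℝ in 𝓝[>] 0, ∀ a ∈ (T : Set ℂ),
      Metric.closedBall a r ⊆ {z | ‖f z - f a‖ < η} :=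
    T.finite_toSet.eventually_all.2 fun a _ =>
      eventually_closedBall_subset (isOpen_lt (by fun_prop) continuous_const)
        (show ‖f a - f a‖ < η by simpa using hη0)
  obtain ⟨r, ⟨⟨⟨hr1, hr2⟩, hr3⟩, hr0⟩⟩ := (((hev1.and hev2).and
    (eventually_two_mul_lt_dist T.finite_toSet)).and self_mem_nhdsWithin).exists
  have hr0 : 0 < r := hr0
  have hCK' : interior C ⊆ Kᶜ := interior_subset.trans hCK
  have hcount : ∀ᶠ k in (𝒰 : Filter ℕ), ∀ a ∈ (T : Set ℂ),
      rootCount (derivative^[m] (q k)) (Metric.ball a r) = rootCount (q k) (Metric.ball a r) := by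
    refine T.finite_toSet.eventually_all.2 fun a ha => ?_
    have hsph : Metric.sphere a r ⊆ Kᶜ :=
      Metric.sphere_subset_closedBall.trans ((hr1 a ha).trans hCK')
    -- The circle contains no limit point: it would belong to `T` and lie at distance `r` from `a`,
    -- against the separation by more than `2 * r`.
    obtain ⟨O, hO, hCO, hOK, hfree⟩ := exists_isOpen_rootFree (𝒰 := 𝒰) hq0 hKo (isCompact_sphere a r)
      hsph (Set.disjoint_left.2 fun z hz hzA => by
        have hzT : z ∈ T := hfin.mem_toFinset.2
          ⟨hzA, hr1 a ha (Metric.sphere_subset_closedBall hz)⟩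
        have h1 : z ≠ a := Metric.ne_of_mem_sphere hz hr0.ne'
        have h2 := hr3 z hzT a ha h1
        rw [Metric.mem_sphere.1 hz] at h2
        linarith)
    exact hq.eventually_rootCount_eq hdeg hdegt hK hωK hC hC0 h𝒰 hO hOK hfree m hr0 hCO
      ((hr1 a ha).trans hCK')
  -- What remains of the support is free of limit points, hence of roots of `q k`. It is also free
  -- of roots of the derivative, whose quotient by `q k` tends, after normalization, to the
  -- nonvanishing `C ^ m`.
  set Z := tsupport f \ ⋃ a ∈ T, Metric.ball a r with hZ
  have hZc : IsCompact Z :=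
    IsCompact.diff hfc (isOpen_biUnion fun a _ => Metric.isOpen_ball)
  have hZK : Z ⊆ Kᶜ := Set.sdiff_subset.trans hfK
  obtain ⟨O, hO, hZO, hOK, hfree⟩ := exists_isOpen_rootFree (𝒰 := 𝒰) hq0 hKo hZc hZK
    (Set.disjoint_left.2 fun z hz hzA => by
      have hzT : z ∈ T := hfin.mem_toFinset.2 ⟨hzA, hSC hz.1⟩
      exact hz.2 (Set.mem_biUnion hzT (Metric.mem_ball_self hr0)))
  have hne := eventually_forall_ne_zero hO
    (hq.tendstoLocallyUniformlyOn_derivQuotient hdeg hdegt hωK hC h𝒰 hO hOK hfree m)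
    ((hC.mono hOK).continuousOn.pow m) hZc hZO fun z hz => pow_ne_zero _ (hC0 z (hZK hz))
  have hvanish : ∀ p : ℂ[X], (∀ z ∈ Z, p.eval z ≠ 0) → ∀ z ∈ p.roots,
      (∀ a ∈ T, z ∉ Metric.ball a r) → f z = 0 := fun p hp z hz hza => by
    by_contra hfz
    refine hp z ⟨subset_tsupport f hfz, fun h => ?_⟩ (mem_roots'.1 hz).2
    obtain ⟨a, ha, hzb⟩ := Set.mem_iUnion₂.1 h
    exact hza a ha hzb
  filter_upwards [hM', hcount, hfree, hne] with k hk1 hk2 hk3 hk4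
  have hosc : ∀ a ∈ T, ∀ z ∈ Metric.ball a r, ‖f z - f a‖ ≤ η := fun a ha z hz =>
    (show ‖f z - f a‖ < η from hr2 a ha (Metric.ball_subset_closedBall hz)).le
  have h1 := norm_sum_roots_sub_le hη0.le hr3 hosc (hvanish (derivative^[m] (q k)) fun z hz h =>
    hk4 z hz (by unfold derivQuotient; rw [h, zero_div]))
  have h2 := norm_sum_roots_sub_le hη0.le hr3 hosc (hvanish (q k) fun z hz => hk3 z (hZO hz))
  rw [Finset.sum_congr rfl fun a ha => by rw [hk2 a ha],
    Finset.sum_congr (f := fun a => (rootCount (derivative^[m] (q k)) (Metric.ball a r) : ℝ)) rfl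
      fun a ha => by rw [hk2 a ha]] at h1
  have h3 : ∑ a ∈ T, (rootCount (q k) (Metric.ball a r) : ℝ) ≤ T.card * M := by
    calc _ ≤ ∑ _a ∈ T, (M : ℝ) := Finset.sum_le_sum fun a ha => by
          exact_mod_cast (rootCount_mono _ (Metric.ball_subset_closedBall.trans
            ((hr1 a ha).trans interior_subset))).trans hk1
      _ = _ := by simp
  have h4 := mul_le_mul_of_nonneg_left h3 hη0.le
  have h5 : η * (T.card * M) < ε / 2 := by
    have : η * (T.card * M + 1) = ε / 2 := by rw [hη]; field_simp
    linarith
  rw [dist_zero_right]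
  set s := ∑ a ∈ T, (rootCount (q k) (Metric.ball a r) : ℂ) * f a
  have h6 := norm_sub_le (((derivative^[m] (q k)).roots.map f).sum - s) (((q k).roots.map f).sum - s)
  rw [sub_sub_sub_cancel_right] at h6
  linarith

end RootSparse

/-! ### The main theorem -/

theorem mainTheorem5 (q : ℕ → Polynomial ℂ)
    (hdeg_pos : ∀ k, 0 < (q k).natDegree)
    (hdeg : Filter.Tendsto (fun k => (q k).natDegree) Filter.atTop Filter.atTop)
    (K : Set ℂ) (hK : IsCompact K) (hK_conn : IsConnected K)
    (hK_polar : ¬ RootSparse.IsPolar K)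
    (hK_conv : RootSparse.IsPolynomiallyConvex K)
    (ω : MeasureTheory.Measure ℂ) (hω : RootSparse.IsEquilibriumMeasure ω K)
    (hlim : RootSparse.WeakStarTendsto (fun k => RootSparse.rootDistribution (q k)) ω)
    (hsparse : RootSparse.IsRootSparse q Kᶜ) :
    ∀ m : ℕ, RootSparse.DivisorTendsto
      (fun k => RootSparse.polyDivisor Kᶜ (Polynomial.derivative^[m] (q k)) -
        RootSparse.polyDivisor Kᶜ (q k)) 0 := by
  intro m f hf hfc hfK
  have := hω.1
  have hq := hlim.rootAvgTendsto hK hω.2.1 hdeg_pos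
  obtain ⟨hC, hC0⟩ := hω.cauchyTransform_ne_zero hK hK_conn hK_polar hK_conv hdeg_pos hq
  have h0 : RootSparse.divisorPairing (0 : Function.locallyFinsuppWithin Kᶜ ℤ) f = 0 := by
    simp [RootSparse.divisorPairing]
  rw [h0]
  have hf0 : ∀ z, z ∉ Kᶜ → f z = 0 := fun z hz => image_eq_zero_of_notMem_tsupport fun h => hz (hfK h)
  have key : Tendsto (fun k => ((derivative^[m] (q k)).roots.map f).sum - ((q k).roots.map f).sum)
      atTop (𝓝 0) := by
    -- Convergence is tested along ultrafilters, where limit points of roots are available without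
    -- passing to subsequences.
    rw [tendsto_iff_ultrafilter]
    exact fun 𝒰 h𝒰 =>
      hq.tendsto_sum_roots_sub hdeg_pos hdeg hK hω.2.1 hC hC0 hsparse h𝒰 m hf hfc hfK
  refine key.congr' ?_
  -- Once the degree exceeds `m` the derivative is nonzero, and its divisor is the one given by its
  -- roots.
  filter_upwards [hdeg.eventually_gt_atTop m] with k hk
  have hp : derivative^[m] (q k) ≠ 0 := fun h => by
    have := RootSparse.natDegree_iterate_derivative_eq (q k) m
    rw [h, natDegree_zero] at this
    omega
  have hq0 : q k ≠ 0 := fun h => by rw [h, natDegree_zero] at hk; omega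
  exact (RootSparse.divisorPairing_polyDivisor_sub hp hq0 hf0).symm
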